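/- All Banach spaces are real. The dimension $\dim Y$ of a Banach space $Y$ is the least cardinality of a subset of $Y$ whose linear span is dense in $Y$ (so it is the linear dimension if $Y$ is finite-dimensional and the density character otherwise). An isomorphic embedding $u:Y\to Z$ is a bounded linear operator that is bounded below; its distortion is $d(u)=\|u\|\,\|u^{-1}\|$, where $u^{-1}:u(Y)\to Y$, with the convention $d(u)=1$ if $Y=\{0\}$. A Banach space $Y$ is finitely representable in $X$, written $Y<_f X$, if for every finite-dimensional subspace $A$ of $Y$ and every $\varepsilon>0$ there is an isomorphic embedding $u:A\to X$ with $d(u)\le 1+\varepsilon$. Let $X^f$ be the class of all Banach spaces $Y$ with $Y<_f X$ and $X<_f Y$. The class $X^f$ has the isomorphic amalgamation property if for all finite-dimensional spaces $A,B_1,B_2$ that are finitely representable in $X$ and all isomorphic embeddings $i_1:A\to B_1$, $i_2:A\to B_2$ there are a finite-dimensional space $F<_f X$ and isomorphic embeddings $j_1:B_1\to F$, $j_2:B_2\to F$ such that $j_1 i_1=j_2 i_2$, $d(j_1)\le d(i_1)$ and $d(j_2)\le d(i_2)$. A Banach space $E$ is $f$-saturated if it is of almost universal disposition with respect to the class of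 all Banach spaces $Y<_f E$ with $\dim Y<\dim E$; that is, if for every such space $B$, every closed subspace $A$ of $B$, every isomorphic embedding $i:A\to E$ and every $\varepsilon>0$ there is an isomorphic embedding $j:B\to E$ with $j|_A=i$ and $d(j)\le(1+\varepsilon)\,d(i)$. A star-cardinal is a regular (infinite) cardinal $\varkappa$ with $\varkappa=\sup\{2^{\tau}:\tau<\varkappa\}$. Theorem. Let $X$ be an infinite-dimensional Banach space such that $X^f$ has the isomorphic amalgamation property. Then for every star-cardinal $\varkappa$ the class $X^f$ contains an $f$-saturated space $E_\varkappa$ of dimension $\varkappa$. -/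

import Mathlib

universe u

noncomputable section

/-- The dimension of a real Banach space: the least cardinality of a subset whose linear span is
dense. It is the linear dimension for finite-dimensional spaces and the density character for
infinite-dimensional ones. -/
def banachDim (X : Type u) [NormedAddCommGroup X] [NormedSpace ℝ X] : Cardinal.{u} :=
  sInf {c | ∃ s : Set X, (Submodule.span ℝ s).topologicalClosure = ⊤ ∧ Cardinal.mk s = c}

/-- An isomorphic embedding: a bounded linear operator that is bounded below. -/
def IsIsomorphicEmbedding {X Y : Type u} [NormedAddCommGroup X] [NormedSpace ℝ X]
    [NormedAddCommGroup Y] [NormedSpace ℝ Y] (T : X →L[ℝ] Y) : Prop :=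
  ∃ c : ℝ, 0 < c ∧ ∀ x, c * ‖x‖ ≤ ‖T x‖

/-- The operator norm of the inverse `T⁻¹ : T X → X` of an isomorphic embedding `T`. -/
def inverseNorm {X Y : Type u} [NormedAddCommGroup X] [NormedSpace ℝ X]
    [NormedAddCommGroup Y] [NormedSpace ℝ Y] (T : X →L[ℝ] Y) : ℝ :=
  sInf {c : ℝ | 0 ≤ c ∧ ∀ x, ‖x‖ ≤ c * ‖T x‖}

/-- The distortion `‖T‖ ‖T⁻¹‖` of an isomorphic embedding `T : X → Y`. When `X ≠ 0` the product
is at least `1`, so the maximum only fixes the convention that the embedding of the zero space is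
isometric, i.e. has distortion `1`. -/
def distortion {X Y : Type u} [NormedAddCommGroup X] [NormedSpace ℝ X]
    [NormedAddCommGroup Y] [NormedSpace ℝ Y] (T : X →L[ℝ] Y) : ℝ :=
  max 1 (‖T‖ * inverseNorm T)

/-- `Y` is finitely representable in `X`. -/
def FinitelyRepresentable (Y X : Type u) [NormedAddCommGroup Y] [NormedSpace ℝ Y]
    [NormedAddCommGroup X] [NormedSpace ℝ X] : Prop :=
  ∀ A : Submodule ℝ Y, FiniteDimensional ℝ A → ∀ ε : ℝ, 0 < ε →
    ∃ T : A →L[ℝ] X, IsIsomorphicEmbedding T ∧ distortion T ≤ 1 + ε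

/-- `Y` and `X` are finitely equivalent, i.e. `Y` belongs to the class `X^f`. -/
def FinitelyEquivalent (Y X : Type u) [NormedAddCommGroup Y] [NormedSpace ℝ Y]
    [NormedAddCommGroup X] [NormedSpace ℝ X] : Prop :=
  FinitelyRepresentable Y X ∧ FinitelyRepresentable X Y

/-- The isomorphic amalgamation property of the class `X^f`: any two isomorphic embeddings
`i₁ : A → B₁`, `i₂ : A → B₂` between finite-dimensional spaces that are finitely representable in
`X` can be amalgamated in a third such space, without increasing the distortions. -/
def HasIsomorphicAmalgamation (X : Type u) [NormedAddCommGroup X] [NormedSpace ℝ X] : Prop :=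
  ∀ (A B₁ B₂ : Type u)
    [NormedAddCommGroup A] [NormedSpace ℝ A] [FiniteDimensional ℝ A]
    [NormedAddCommGroup B₁] [NormedSpace ℝ B₁] [FiniteDimensional ℝ B₁]
    [NormedAddCommGroup B₂] [NormedSpace ℝ B₂] [FiniteDimensional ℝ B₂],
    FinitelyRepresentable A X → FinitelyRepresentable B₁ X → FinitelyRepresentable B₂ X →
    ∀ (i₁ : A →L[ℝ] B₁) (i₂ : A →L[ℝ] B₂),
      IsIsomorphicEmbedding i₁ → IsIsomorphicEmbedding i₂ →
      ∃ (F : Type u) (_ : NormedAddCommGroup F) (_ : NormedSpace ℝ F),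
        FiniteDimensional ℝ F ∧ FinitelyRepresentable F X ∧
        ∃ (j₁ : B₁ →L[ℝ] F) (j₂ : B₂ →L[ℝ] F),
          IsIsomorphicEmbedding j₁ ∧ IsIsomorphicEmbedding j₂ ∧
          (∀ a, j₁ (i₁ a) = j₂ (i₂ a)) ∧
          distortion j₁ ≤ distortion i₁ ∧ distortion j₂ ≤ distortion i₂

/-- `E` is a space of almost universal disposition with respect to the class `K` of Banach
spaces: for all `A ⊆ B` in `K` and `ε > 0`, every isomorphic embedding `i : A → E` extends to an
isomorphic embedding of `B` whose distortion is at most `(1 + ε)` times that of `i`. -/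
def IsOfAlmostUniversalDisposition (E : Type u) [NormedAddCommGroup E] [NormedSpace ℝ E]
    (K : ∀ (Y : Type u) [NormedAddCommGroup Y] [NormedSpace ℝ Y], Prop) : Prop :=
  ∀ (B : Type u) [NormedAddCommGroup B] [NormedSpace ℝ B] [CompleteSpace B]
    (A : Submodule ℝ B), IsClosed (A : Set B) → K A → K B →
    ∀ i : A →L[ℝ] E, IsIsomorphicEmbedding i → ∀ ε : ℝ, 0 < ε →
      ∃ j : B →L[ℝ] E, IsIsomorphicEmbedding j ∧ (∀ a : A, j (a : B) = i a) ∧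
        distortion j ≤ (1 + ε) * distortion i

/-- `E` is `f`-saturated: it is of almost universal disposition with respect to the class of all
Banach spaces that are finitely representable in `E` and have dimension less than that of `E`. -/
def IsFSaturated (E : Type u) [NormedAddCommGroup E] [NormedSpace ℝ E] : Prop :=
  IsOfAlmostUniversalDisposition E
    (fun Y _ _ => FinitelyRepresentable Y E ∧ banachDim Y < banachDim E)

/-- A star-cardinal: a regular (in particular infinite) cardinal `κ` that is equal to the
supremum of `2 ^ τ` over all cardinals `τ < κ`. -/
def IsStarCardinal (κ : Cardinal.{u}) : Prop :=
  κ.IsRegular ∧ κ = ⨆ τ : Set.Iio κ, (2 : Cardinal.{u}) ^ (τ : Cardinal.{u})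

end

open Filter Topology

/-! The space is built as a completion of the free vector space on `κ` well-ordered coordinates,
under a seminorm generic among those finitely representable in `X`. Working with seminorms on bare
vector spaces makes pull-backs and pointwise limits cheap: `Seminorm.FinRep` is preserved by
composition with any linear map and by limits (`Seminorm.FinRep.of_tendsto`), so compactness
arguments are ultrafilter limits.

A requirement at coordinate `i` asks the `i`-th basis vector to satisfy a set of fewer than `κ`
rational norm conditions over earlier coordinates. Requirements are met in order whenever they are
satisfiable (`exists_seminorm_meetsRequirement`). Since `κ` is a star-cardinal there are at most `κ`
such sets, and each can be scheduled unboundedly often; by regularity the parameters of a small set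
lie below some stage. Hence the completion `E` imitates every one-dimensional extension
representable in `X` on fewer than `κ` points (`RealizesExtensions`).

Amalgamation turns this into saturation. Given `g` from a subspace of `B` to `E`, gluing `B` to `E`
along `g` yields a one-dimensional extension of `E` by the image of a new vector `b`, with the
two-sided bounds of `g` intact (`HasIsomorphicAmalgamation.exists_seminorm`). Realizing it in `E`
extends `g` to `b`. For uncountable `κ` this is lossless and Zorn's lemma finishes; for `κ = ℵ₀` the
space `B` is finite-dimensional and finitely many small losses are affordable. That `E` has
dimension at least `κ` follows by imitating a vector at distance at least `1` from `E`. -/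

/-- A seminorm `p` is finitely representable in `X`: on each finite-dimensional subspace it is,
up to a factor `1 + ε`, the pull-back of the norm of `X` under a linear map. -/
def Seminorm.FinRep {V : Type*} [AddCommGroup V] [Module ℝ V] (p : Seminorm ℝ V)
    (X : Type*) [NormedAddCommGroup X] [NormedSpace ℝ X] : Prop :=
  ∀ A : Submodule ℝ V, FiniteDimensional ℝ A → ∀ ε : ℝ, 0 < ε →
    ∃ T : V →ₗ[ℝ] X, ∀ a ∈ A, p a ≤ ‖T a‖ ∧ ‖T a‖ ≤ (1 + ε) * p a

/-! ### Finitely representable seminorms and their limits -/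

section Seminorms

variable {V W : Type*} [AddCommGroup V] [Module ℝ V] [AddCommGroup W] [Module ℝ W]
variable {X : Type*} [NormedAddCommGroup X] [NormedSpace ℝ X]

theorem Seminorm.FinRep.comp {p : Seminorm ℝ V} (hp : p.FinRep X) (f : W →ₗ[ℝ] V) :
    (p.comp f).FinRep X := by
  intro A hA ε hε
  obtain ⟨T, hT⟩ := hp (A.map f) inferInstance ε hε
  exact ⟨T ∘ₗ f, fun a ha => hT (f a) (Submodule.mem_map_of_mem ha)⟩

theorem Seminorm.finRep_normSeminorm_self : (normSeminorm ℝ X).FinRep X := by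
  intro A _ ε hε
  refine ⟨LinearMap.id, fun a _ => ⟨le_rfl, ?_⟩⟩
  change ‖a‖ ≤ (1 + ε) * ‖a‖
  nlinarith [norm_nonneg a]

theorem Seminorm.eq_of_sub_eq_zero (p : Seminorm ℝ V) {x y : V} (h : p (x - y) = 0) :
    p x = p y := by
  have := abs_sub_map_le_sub p x y
  rw [h] at this
  exact sub_eq_zero.1 (abs_nonpos_iff.1 this)

/-- It is enough to test finite representability on subspaces where the seminorm is a norm. -/
theorem Seminorm.FinRep.of_definite {p : Seminorm ℝ V}
    (h : ∀ A : Submodule ℝ V, FiniteDimensional ℝ A → (∀ a ∈ A, p a = 0 → a = 0) →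
      ∀ ε : ℝ, 0 < ε → ∃ T : V →ₗ[ℝ] X, ∀ a ∈ A, p a ≤ ‖T a‖ ∧ ‖T a‖ ≤ (1 + ε) * p a) :
    p.FinRep X := by
  intro A hA ε hε
  let K : Submodule ℝ V :=
    { carrier := {v | p v = 0}
      add_mem' := fun {a b} ha hb => le_antisymm
        ((map_add_le_add p a b).trans (by simp only [Set.mem_ofPred_eq] at ha hb; simp [ha, hb]))
        (apply_nonneg p _)
      zero_mem' := map_zero p
      smul_mem' := fun c x hx => by
        simp only [Set.mem_ofPred_eq] at hx ⊢
        simp [map_smul_eq_mul, hx] }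
  -- For a linear section `s`, the map `s ∘ₗ K.mkQ` moves vectors only within the kernel `K` of `p`.
  -- It therefore preserves `p`, and its image meets `K` trivially.
  obtain ⟨s, hs⟩ := K.mkQ.exists_rightInverse_of_surjective (by simp)
  have hs' : ∀ u, K.mkQ (s u) = u := fun u => LinearMap.congr_fun hs u
  have hπ : ∀ v, p (s (K.mkQ v)) = p v := by
    intro v
    apply p.eq_of_sub_eq_zero
    have : s (K.mkQ v) - v ∈ K := by
      rw [← Submodule.Quotient.mk_eq_zero, ← Submodule.mkQ_apply, map_sub, hs', sub_self]
    exact this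
  obtain ⟨T, hT⟩ := h (A.map (s ∘ₗ K.mkQ)) inferInstance (by
    rintro _ ⟨a, _, rfl⟩ h0
    have h1 : s (K.mkQ a) ∈ K := h0
    rw [← Submodule.Quotient.mk_eq_zero, ← Submodule.mkQ_apply, hs'] at h1
    simp [h1]) ε hε
  refine ⟨T ∘ₗ s ∘ₗ K.mkQ, fun a ha => ?_⟩
  have := hT _ (Submodule.mem_map_of_mem ha)
  simpa only [LinearMap.comp_apply, hπ] using this

/-- On a finite-dimensional space, seminorms that converge pointwise to a norm are eventually
close to it in ratio. -/
theorem Seminorm.eventually_ratio_le [FiniteDimensional ℝ W] {ι : Type*} {l : Filter ι}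
    {r : ι → Seminorm ℝ W} {p : Seminorm ℝ W} (hp : ∀ w, p w = 0 → w = 0)
    (h : ∀ w, Tendsto (fun i => r i w) l (𝓝 (p w))) {ε : ℝ} (hε : 0 < ε) :
    ∀ᶠ i in l, ∀ w, (1 - ε) * p w ≤ r i w ∧ r i w ≤ (1 + ε) * p w := by
  let _ : NormedAddCommGroup W := AddGroupNorm.toNormedAddCommGroup
    { toFun := p
      map_zero' := map_zero p
      add_le' := map_add_le_add p
      neg' := map_neg_eq_map p
      eq_zero_of_map_eq_zero' := hp }
  have hn : ∀ w, ‖w‖ = p w := fun w => rfl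
  let _ : NormedSpace ℝ W := ⟨fun c w => by rw [hn, hn, map_smul_eq_mul]⟩
  have _ : ProperSpace W := FiniteDimensional.proper_real W
  let b := Module.finBasis ℝ W
  let φ : Fin (Module.finrank ℝ W) → W →L[ℝ] ℝ := fun k => LinearMap.toContinuousLinearMap (b.coord k)
  set C : ℝ := 1 + ∑ k, ‖φ k‖ * (p (b k) + 1) with hC
  have hCpos : 0 < C := by
    have : 0 ≤ ∑ k, ‖φ k‖ * (p (b k) + 1) :=
      Finset.sum_nonneg fun k _ => mul_nonneg (norm_nonneg _) (by linarith [apply_nonneg p (b k)])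
    linarith
  have hbd : ∀ᶠ i in l, ∀ w, r i w ≤ C * ‖w‖ := by
    have h1 : ∀ᶠ i in l, ∀ k, r i (b k) ≤ p (b k) + 1 := by
      rw [eventually_all]
      intro k
      exact (h (b k)).eventually_le_const (by linarith)
    filter_upwards [h1] with i hi w
    calc r i w = r i (∑ k, b.repr w k • b k) := by rw [b.sum_repr]
      _ ≤ ∑ k, r i (b.repr w k • b k) := Finset.le_sum_of_subadditive (r i) (map_zero (r i)).le (map_add_le_add _) _ _
      _ ≤ ∑ k, (‖φ k‖ * (p (b k) + 1)) * ‖w‖ := by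
        refine Finset.sum_le_sum fun k _ => ?_
        rw [map_smul_eq_mul]
        have h2 : ‖b.repr w k‖ ≤ ‖φ k‖ * ‖w‖ := (φ k).le_opNorm w
        calc ‖b.repr w k‖ * r i (b k) ≤ (‖φ k‖ * ‖w‖) * (p (b k) + 1) :=
              mul_le_mul h2 (hi k) (apply_nonneg _ _) (by positivity)
          _ = _ := by ring
      _ ≤ C * ‖w‖ := by
        rw [← Finset.sum_mul]
        exact mul_le_mul_of_nonneg_right (by linarith) (norm_nonneg _)
  -- Eventually `r i ≤ C * p`, so passing from the unit sphere to an `η`-net costs `ε / 2`;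
  -- convergence on the finite net costs the other half.
  set η : ℝ := ε / (2 * C) with hη
  have hηpos : 0 < η := by positivity
  obtain ⟨t, hts, htfin, hcov⟩ := (isCompact_sphere (0 : W) 1).finite_cover_balls hηpos
  have hnet : ∀ᶠ i in l, ∀ x ∈ t, |r i x - p x| < ε / 2 := by
    rw [eventually_all_finite htfin]
    intro x _
    filter_upwards [(h x).eventually (Metric.ball_mem_nhds (p x) (half_pos hε))] with i hi
    simpa [Real.dist_eq] using hi
  filter_upwards [hbd, hnet] with i h1 h2 w
  rcases eq_or_ne w 0 with rfl | hw
  · simp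
  have hw0 : 0 < ‖w‖ := norm_pos_iff.2 hw
  set y := ‖w‖⁻¹ • w with hy
  have hy1 : ‖y‖ = 1 := by rw [hy, norm_smul, norm_inv, norm_norm, inv_mul_cancel₀ hw0.ne']
  have hwy : w = ‖w‖ • y := by rw [hy, smul_smul, mul_inv_cancel₀ hw0.ne', one_smul]
  obtain ⟨x, hxt, hxy⟩ : ∃ x ∈ t, y ∈ Metric.ball x η := by
    have := hcov (show y ∈ Metric.sphere (0 : W) 1 by simpa using hy1)
    simpa using this
  have hx1 : p x = 1 := by simpa [hn] using hts hxt
  have h3 := abs_lt.1 (h2 x hxt)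
  have h4 : |r i y - r i x| ≤ ε / 2 := by
    refine (abs_sub_map_le_sub (r i) y x).trans ((h1 _).trans ?_)
    rw [Metric.mem_ball, dist_eq_norm] at hxy
    calc C * ‖y - x‖ ≤ C * η := mul_le_mul_of_nonneg_left hxy.le hCpos.le
      _ = ε / 2 := by rw [hη]; field_simp
  have h5 := abs_le.1 h4
  rw [hx1] at h3
  have h6 : r i w = ‖w‖ * r i y := by
    conv_lhs => rw [hwy]
    rw [map_smul_eq_mul, norm_norm]
  rw [h6, ← hn]
  constructor <;> nlinarith

/-- Bounded families of seminorms have limits along ultrafilters. -/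
theorem Seminorm.exists_tendsto_of_bounded {ι : Type*} (l : Ultrafilter ι) (r : ι → Seminorm ℝ W)
    (h : ∀ w, ∃ C, ∀ᶠ i in l, r i w ≤ C) :
    ∃ p : Seminorm ℝ W, ∀ w, Tendsto (fun i => r i w) l (𝓝 (p w)) := by
  have h1 : ∀ w, ∃ c, Tendsto (fun i => r i w) l (𝓝 c) := by
    intro w
    obtain ⟨C, hC⟩ := h w
    obtain ⟨c, -, hc⟩ := (isCompact_Icc (a := (0 : ℝ)) (b := C)).ultrafilter_le_nhds
      (l.map fun i => r i w) (by
        rw [le_principal_iff]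
        change ∀ᶠ i in l, r i w ∈ Set.Icc 0 C
        filter_upwards [hC] with i hi using ⟨apply_nonneg _ _, hi⟩)
    exact ⟨c, hc⟩
  choose p hp using h1
  refine ⟨Seminorm.of p (fun x y => ?_) (fun c x => ?_), hp⟩
  · exact le_of_tendsto_of_tendsto' (hp (x + y)) ((hp x).add (hp y))
      fun i => map_add_le_add (r i) x y
  · refine tendsto_nhds_unique (hp (c • x)) ?_
    simpa only [map_smul_eq_mul] using (hp x).const_mul ‖c‖

/-- Finite representability passes to pointwise limits. -/
theorem Seminorm.FinRep.of_tendsto {ι : Type*} {l : Filter ι} [l.NeBot] {r : ι → Seminorm ℝ W}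
    {p : Seminorm ℝ W} (h : ∀ w, Tendsto (fun i => r i w) l (𝓝 (p w)))
    (hr : ∀ᶠ i in l, (r i).FinRep X) : p.FinRep X := by
  refine Seminorm.FinRep.of_definite fun A hA hdef ε hε => ?_
  -- One factor `1 + δ` comes from comparing `r i` with `p`, the other from representing `r i`;
  -- rescaling by `(1 - δ)⁻¹` restores the lower bound.
  obtain ⟨δ, hδ0, hδ1, hδ⟩ : ∃ δ : ℝ, 0 < δ ∧ δ < 1 ∧ (1 + δ) * (1 + δ) ≤ (1 + ε) * (1 - δ) := by
    refine ⟨min (1 / 2) (ε / (4 + ε)), by positivity, by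
      linarith [min_le_left (1 / 2 : ℝ) (ε / (4 + ε))], ?_⟩
    have h1 := min_le_left (1 / 2 : ℝ) (ε / (4 + ε))
    have h2 := min_le_right (1 / 2 : ℝ) (ε / (4 + ε))
    have h0 : 0 < min (1 / 2 : ℝ) (ε / (4 + ε)) := by positivity
    rw [le_div_iff₀ (by positivity)] at h2
    nlinarith
  have h1 := Seminorm.eventually_ratio_le (W := A) (l := l) (r := fun i => (r i).comp A.subtype)
    (p := p.comp A.subtype) (fun w hw => Subtype.ext (hdef w w.2 hw)) (fun w => h w) hδ0
  obtain ⟨i, hi, hri⟩ := (h1.and hr).exists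
  obtain ⟨T, hT⟩ := hri A hA δ hδ0
  refine ⟨(1 - δ)⁻¹ • T, fun a ha => ?_⟩
  obtain ⟨h3, h4⟩ := hT a ha
  obtain ⟨h5, h6⟩ : (1 - δ) * p a ≤ r i a ∧ r i a ≤ (1 + δ) * p a := hi ⟨a, ha⟩
  have hpos : 0 < 1 - δ := by linarith
  rw [LinearMap.smul_apply, norm_smul, Real.norm_of_nonneg (by positivity),
    ← div_eq_inv_mul, le_div_iff₀ hpos, div_le_iff₀ hpos]
  refine ⟨by linarith, ?_⟩
  have : (1 + δ) * r i a ≤ (1 + δ) * ((1 + δ) * p a) := mul_le_mul_of_nonneg_left h6 (by linarith)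
  nlinarith [apply_nonneg p a]

end Seminorms

/-! ### Distortion in terms of two-sided bounds -/

section Distortion

variable {Y Z : Type u} [NormedAddCommGroup Y] [NormedSpace ℝ Y]
  [NormedAddCommGroup Z] [NormedSpace ℝ Z]

theorem isIsomorphicEmbedding_of_bounds {T : Y →L[ℝ] Z} {m M : ℝ} (hm : 0 < m)
    (h : ∀ x, m * ‖x‖ ≤ ‖T x‖ ∧ ‖T x‖ ≤ M * ‖x‖) : IsIsomorphicEmbedding T :=
  ⟨m, hm, fun x => (h x).1⟩

theorem distortion_le_of_bounds {T : Y →L[ℝ] Z} {m M : ℝ} (hm : 0 < m) (hmM : m ≤ M)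
    (h : ∀ x, m * ‖x‖ ≤ ‖T x‖ ∧ ‖T x‖ ≤ M * ‖x‖) : distortion T ≤ M / m := by
  refine max_le ((one_le_div hm).2 hmM) ?_
  have h1 : ‖T‖ ≤ M := T.opNorm_le_bound (hm.le.trans hmM) fun x => (h x).2
  have h2 : inverseNorm T ≤ m⁻¹ := by
    refine csInf_le ⟨0, fun c hc => hc.1⟩ ⟨by positivity, fun x => ?_⟩
    rw [← div_eq_inv_mul, le_div_iff₀ hm, mul_comm]
    exact (h x).1
  have h3 : 0 ≤ inverseNorm T := Real.sInf_nonneg fun c hc => hc.1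
  rw [div_eq_mul_inv]
  exact mul_le_mul h1 h2 h3 (hm.le.trans hmM)

/-- The constants are the optimal ones, `(inverseNorm T)⁻¹` and `‖T‖`. On the zero space, where
these degenerate, `m = M = 1` agrees with the convention of distortion `1`. -/
theorem IsIsomorphicEmbedding.exists_bounds {T : Y →L[ℝ] Z} (hT : IsIsomorphicEmbedding T) :
    ∃ m M : ℝ, 0 < m ∧ m ≤ M ∧ (∀ x, m * ‖x‖ ≤ ‖T x‖ ∧ ‖T x‖ ≤ M * ‖x‖) ∧
      M ≤ distortion T * m := by
  rcases subsingleton_or_nontrivial Y with hY | hY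
  · refine ⟨1, 1, one_pos, le_rfl, fun x => ?_, ?_⟩
    · rw [Subsingleton.elim x 0]
      simp
    · simp [distortion]
  obtain ⟨c, hc, hcT⟩ := hT
  have hinv : ∀ x, ‖x‖ ≤ inverseNorm T * ‖T x‖ := by
    intro x
    rcases eq_or_ne x 0 with rfl | hx
    · simp
    have hTx : 0 < ‖T x‖ := lt_of_lt_of_le (mul_pos hc (norm_pos_iff.2 hx)) (hcT x)
    rw [← div_le_iff₀ hTx]
    refine le_csInf ⟨c⁻¹, by positivity, fun y => ?_⟩ fun b hb => ?_
    · rw [← div_eq_inv_mul, le_div_iff₀ hc, mul_comm]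
      exact hcT y
    · rw [div_le_iff₀ hTx]
      exact hb.2 x
  obtain ⟨x, hx⟩ := exists_ne (0 : Y)
  have hx0 := norm_pos_iff.2 hx
  have hK : 0 < inverseNorm T := by
    by_contra hK
    have := (hinv x).trans (mul_nonpos_of_nonpos_of_nonneg (not_lt.1 hK) (norm_nonneg _))
    linarith
  have hlow : ∀ x, (inverseNorm T)⁻¹ * ‖x‖ ≤ ‖T x‖ := by
    intro x
    rw [← div_eq_inv_mul, div_le_iff₀ hK, mul_comm]
    exact hinv x
  refine ⟨(inverseNorm T)⁻¹, ‖T‖, by positivity, ?_, fun x => ⟨hlow x, T.le_opNorm x⟩, ?_⟩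
  · exact le_of_mul_le_mul_right ((hlow x).trans (T.le_opNorm x)) hx0
  · rw [← div_eq_mul_inv, le_div_iff₀ hK]
    exact le_max_right _ _

end Distortion

/-! ### Finite representability of spaces versus seminorms -/

section Representable

variable {Y X : Type u} [NormedAddCommGroup Y] [NormedSpace ℝ Y]
  [NormedAddCommGroup X] [NormedSpace ℝ X]

theorem FinitelyRepresentable.finRep (h : FinitelyRepresentable Y X) :
    (normSeminorm ℝ Y).FinRep X := by
  intro A hA ε hε
  obtain ⟨T, hT, hd⟩ := h A hA ε hε
  obtain ⟨m, M, hm, hmM, hb, hM⟩ := hT.exists_bounds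
  obtain ⟨S, hS⟩ := LinearMap.exists_extend (T : A →ₗ[ℝ] X)
  refine ⟨m⁻¹ • S, fun a ha => ?_⟩
  have hSa : S a = T ⟨a, ha⟩ := LinearMap.congr_fun hS ⟨a, ha⟩
  obtain ⟨h1, h2⟩ : m * ‖a‖ ≤ ‖T ⟨a, ha⟩‖ ∧ ‖T ⟨a, ha⟩‖ ≤ M * ‖a‖ := hb ⟨a, ha⟩
  rw [LinearMap.smul_apply, norm_smul, hSa, Real.norm_of_nonneg (by positivity), coe_normSeminorm,
    ← div_eq_inv_mul, le_div_iff₀ hm, div_le_iff₀ hm]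
  have h3 : M ≤ (1 + ε) * m := hM.trans (mul_le_mul_of_nonneg_right hd hm.le)
  refine ⟨by linarith, h2.trans ?_⟩
  nlinarith [norm_nonneg a]

theorem Seminorm.FinRep.finitelyRepresentable (h : (normSeminorm ℝ Y).FinRep X) :
    FinitelyRepresentable Y X := by
  intro A hA ε hε
  obtain ⟨T, hT⟩ := h A hA ε hε
  have hb : ∀ x : A, 1 * ‖x‖ ≤ ‖LinearMap.toContinuousLinearMap (T ∘ₗ A.subtype) x‖ ∧
      ‖LinearMap.toContinuousLinearMap (T ∘ₗ A.subtype) x‖ ≤ (1 + ε) * ‖x‖ := by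
    intro x
    rw [one_mul]
    exact hT x x.2
  refine ⟨LinearMap.toContinuousLinearMap (T ∘ₗ A.subtype),
    isIsomorphicEmbedding_of_bounds one_pos hb, ?_⟩
  simpa using distortion_le_of_bounds one_pos (by linarith) hb

theorem Seminorm.FinRep.trans {V : Type*} [AddCommGroup V] [Module ℝ V] {p : Seminorm ℝ V}
    (hp : p.FinRep Y) (h : (normSeminorm ℝ Y).FinRep X) : p.FinRep X := by
  intro A hA ε hε
  obtain ⟨δ, hδ0, hδ⟩ : ∃ δ : ℝ, 0 < δ ∧ (1 + δ) * (1 + δ) ≤ 1 + ε := by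
    refine ⟨min 1 (ε / 3), by positivity, ?_⟩
    have h1 := min_le_left 1 (ε / 3)
    have h2 := min_le_right 1 (ε / 3)
    have h0 : 0 < min 1 (ε / 3) := by positivity
    nlinarith
  obtain ⟨T, hT⟩ := hp A hA δ hδ0
  obtain ⟨S, hS⟩ := h (A.map T) inferInstance δ hδ0
  refine ⟨S ∘ₗ T, fun a ha => ?_⟩
  obtain ⟨h1, h2⟩ := hT a ha
  obtain ⟨h3, h4⟩ : ‖T a‖ ≤ ‖S (T a)‖ ∧ ‖S (T a)‖ ≤ (1 + δ) * ‖T a‖ :=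
    hS _ (Submodule.mem_map_of_mem ha)
  refine ⟨h1.trans h3, h4.trans ?_⟩
  have h5 : (1 + δ) * ‖T a‖ ≤ (1 + δ) * ((1 + δ) * p a) :=
    mul_le_mul_of_nonneg_left h2 (by linarith)
  nlinarith [apply_nonneg p a]

theorem Seminorm.FinRep.submodule (h : (normSeminorm ℝ Y).FinRep X) (A : Submodule ℝ Y) :
    (normSeminorm ℝ A).FinRep X :=
  h.comp A.subtype

end Representable

/-! ### Amalgamation in arbitrary dimension and proper extensions -/

section Amalgamation

variable {X : Type u} [NormedAddCommGroup X] [NormedSpace ℝ X]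

/-- Amalgamation over an isometric copy of the base, with control of the norm on both factors. -/
theorem HasIsomorphicAmalgamation.exists_seminorm_finiteDimensional
    (hX : HasIsomorphicAmalgamation X) {A B E : Type u}
    [NormedAddCommGroup A] [NormedSpace ℝ A] [FiniteDimensional ℝ A]
    [NormedAddCommGroup B] [NormedSpace ℝ B] [FiniteDimensional ℝ B]
    [NormedAddCommGroup E] [NormedSpace ℝ E] [FiniteDimensional ℝ E]
    (hA : (normSeminorm ℝ A).FinRep X) (hB : (normSeminorm ℝ B).FinRep X)
    (hE : (normSeminorm ℝ E).FinRep X) (i : A →ₗ[ℝ] B) (k : A →ₗ[ℝ] E) {m M : ℝ} (hm : 0 < m)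
    (hmM : m ≤ M) (hi : ∀ a, m * ‖i a‖ ≤ ‖a‖ ∧ ‖a‖ ≤ M * ‖i a‖) (hk : ∀ a, ‖k a‖ = ‖a‖) :
    ∃ r : Seminorm ℝ (E × B), r.FinRep X ∧ (∀ e, r (e, 0) = ‖e‖) ∧
      (∀ b, m * ‖b‖ ≤ r (0, b) ∧ r (0, b) ≤ M * ‖b‖) ∧ ∀ a, r (k a, -i a) = 0 := by
  have hM : 0 < M := hm.trans_le hmM
  set I := LinearMap.toContinuousLinearMap i with hI
  set K := LinearMap.toContinuousLinearMap k with hK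
  have hIa : ∀ a, I a = i a := fun a => rfl
  have hKa : ∀ a, K a = k a := fun a => rfl
  have bI : ∀ a, M⁻¹ * ‖a‖ ≤ ‖I a‖ ∧ ‖I a‖ ≤ m⁻¹ * ‖a‖ := by
    intro a
    rw [hIa, ← div_eq_inv_mul, ← div_eq_inv_mul, div_le_iff₀ hM, le_div_iff₀ hm]
    exact ⟨by linarith [(hi a).2], by linarith [(hi a).1]⟩
  have bK : ∀ a, 1 * ‖a‖ ≤ ‖K a‖ ∧ ‖K a‖ ≤ 1 * ‖a‖ := fun a => by simp [hKa, hk]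
  obtain ⟨F, _, _, hF, hFX, j₁, j₂, hj₁, hj₂, hj, hd₁, hd₂⟩ := hX A B E
    hA.finitelyRepresentable hB.finitelyRepresentable hE.finitelyRepresentable I K
    (isIsomorphicEmbedding_of_bounds (by positivity) bI)
    (isIsomorphicEmbedding_of_bounds one_pos bK)
  obtain ⟨m₁, M₁, hm₁, hmM₁, b₁, hM₁⟩ := hj₁.exists_bounds
  obtain ⟨m₂, M₂, hm₂, hmM₂, b₂, hM₂⟩ := hj₂.exists_bounds
  -- The leg `K` is isometric, so `j₂` has distortion `1` and is a multiple of an isometry.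
  have hM₂' : M₂ ≤ m₂ := by
    have h1 := distortion_le_of_bounds one_pos le_rfl bK
    have h2 := mul_le_mul_of_nonneg_right (hd₂.trans h1) hm₂.le
    linarith
  have e₂ : ∀ b, ‖j₂ b‖ = m₂ * ‖b‖ := fun b => le_antisymm
    ((b₂ b).2.trans (mul_le_mul_of_nonneg_right hM₂' (norm_nonneg _))) (b₂ b).1
  have hM₁' : M₁ ≤ distortion I * m₁ := hM₁.trans (mul_le_mul_of_nonneg_right hd₁ hm₁.le)
  have hM₁pos : 0 < M₁ := hm₁.trans_le hmM₁
  suffices H : ∃ c : ℝ, 0 < c ∧ (∀ b, m * ‖b‖ ≤ c * ‖j₁ b‖ ∧ c * ‖j₁ b‖ ≤ M * ‖b‖) ∧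
      ∀ a, c • j₁ (i a) = m₂⁻¹ • j₂ (k a) by
    obtain ⟨c, hc, hcb, hca⟩ := H
    refine ⟨(normSeminorm ℝ F).comp (LinearMap.coprod (m₂⁻¹ • (j₂ : E →ₗ[ℝ] F))
      (c • (j₁ : B →ₗ[ℝ] F))), hFX.finRep.comp _, fun e => ?_, fun b => ?_, fun a => ?_⟩
    · simp [Seminorm.comp_apply, norm_smul, e₂, abs_of_pos hm₂, hm₂.ne']
    · simpa [Seminorm.comp_apply, norm_smul, abs_of_pos hc] using hcb b
    · have : m₂⁻¹ • j₂ (k a) + -(c • j₁ (i a)) = 0 := by rw [hca, add_neg_cancel]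
      simpa [Seminorm.comp_apply] using this
  -- If `A = 0`, gluing imposes nothing and the scale `c` is free. Otherwise gluing forces `c =
  -- m₂⁻¹`.
  rcases subsingleton_or_nontrivial A with hA' | hA'
  · have h1 : distortion I ≤ 1 := by
      simpa using distortion_le_of_bounds (T := I) one_pos le_rfl
        fun a => by rw [Subsingleton.elim a 0]; simp
    have h2 : M₁ ≤ m₁ := by nlinarith
    have e₁ : ∀ b, ‖j₁ b‖ = m₁ * ‖b‖ := fun b => le_antisymm
      ((b₁ b).2.trans (mul_le_mul_of_nonneg_right h2 (norm_nonneg _))) (b₁ b).1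
    refine ⟨m / m₁, by positivity, fun b => ?_, fun a => ?_⟩
    · have : m / m₁ * ‖j₁ b‖ = m * ‖b‖ := by rw [e₁]; field_simp
      rw [this]
      exact ⟨le_rfl, mul_le_mul_of_nonneg_right hmM (norm_nonneg _)⟩
    · rw [Subsingleton.elim a 0]
      simp
  · have hja : ∀ a, ‖j₁ (I a)‖ = m₂ * ‖a‖ := fun a => by rw [hj, e₂, hKa, hk]
    obtain ⟨a₀, ha₀⟩ := exists_ne (0 : A)
    have ha₀' := norm_pos_iff.2 ha₀
    -- Since `j₁ ∘ I` scales norms by `m₂`, the bounds of `j₁` give new bounds for `I`. Replacing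
    -- only one of the original bounds at a time gives two estimates of `distortion I`; each, put
    -- into `M₁ ≤ distortion I * m₁`, controls one side of `j₁`.
    have bU : ∀ a, M⁻¹ * ‖a‖ ≤ ‖I a‖ ∧ ‖I a‖ ≤ (m₂ / m₁) * ‖a‖ := by
      refine fun a => ⟨(bI a).1, ?_⟩
      have := (b₁ (I a)).1
      rw [hja] at this
      rw [div_mul_eq_mul_div, le_div_iff₀ hm₁]
      linarith
    have bL : ∀ a, (m₂ / M₁) * ‖a‖ ≤ ‖I a‖ ∧ ‖I a‖ ≤ m⁻¹ * ‖a‖ := by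
      refine fun a => ⟨?_, (bI a).2⟩
      have := (b₁ (I a)).2
      rw [hja] at this
      rw [div_mul_eq_mul_div, div_le_iff₀ hM₁pos]
      linarith
    have dU := distortion_le_of_bounds (by positivity)
      (le_of_mul_le_mul_right ((bU a₀).1.trans (bU a₀).2) ha₀') bU
    have dL := distortion_le_of_bounds (by positivity)
      (le_of_mul_le_mul_right ((bL a₀).1.trans (bL a₀).2) ha₀') bL
    have hup : M₁ ≤ m₂ * M := by
      calc M₁ ≤ distortion I * m₁ := hM₁'
        _ ≤ (m₂ / m₁ / M⁻¹) * m₁ := mul_le_mul_of_nonneg_right dU hm₁.le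
        _ = m₂ * M := by field_simp
    have hlow : m * m₂ ≤ m₁ := by
      have h1 : M₁ ≤ (m⁻¹ / (m₂ / M₁)) * m₁ := hM₁'.trans (mul_le_mul_of_nonneg_right dL hm₁.le)
      have h2 : (m⁻¹ / (m₂ / M₁)) * m₁ = M₁ * (m₁ / (m * m₂)) := by field_simp
      rw [h2] at h1
      have h3 : 1 ≤ m₁ / (m * m₂) := le_of_mul_le_mul_left (by linarith) hM₁pos
      rwa [one_le_div (by positivity)] at h3
    refine ⟨m₂⁻¹, by positivity, fun b => ?_, fun a => by rw [← hIa, hj, hKa]⟩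
    rw [← div_eq_inv_mul, le_div_iff₀ hm₂, div_le_iff₀ hm₂]
    constructor
    · calc m * ‖b‖ * m₂ = (m * m₂) * ‖b‖ := by ring
        _ ≤ m₁ * ‖b‖ := mul_le_mul_of_nonneg_right hlow (norm_nonneg _)
        _ ≤ _ := (b₁ b).1
    · calc ‖j₁ b‖ ≤ M₁ * ‖b‖ := (b₁ b).2
        _ ≤ (m₂ * M) * ‖b‖ := mul_le_mul_of_nonneg_right hup (norm_nonneg _)
        _ = _ := by ring

variable {B E : Type u} [NormedAddCommGroup B] [NormedSpace ℝ B]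
  [NormedAddCommGroup E] [NormedSpace ℝ E]

/-- The base is the image of `D₀` with the norm of `E`: its inclusion in `E` is then isometric, and
all distortion sits on the leg into `B`. The resulting seminorm is pulled back to `E × B` along
linear projections, whose continuity is irrelevant. -/
theorem HasIsomorphicAmalgamation.exists_seminorm_submodule
    (hX : HasIsomorphicAmalgamation X) (hB : (normSeminorm ℝ B).FinRep X)
    (hE : (normSeminorm ℝ E).FinRep X) {D : Submodule ℝ B} (f : D →ₗ[ℝ] E) {m M : ℝ} (hm : 0 < m)
    (hmM : m ≤ M) (hf : ∀ d, m * ‖d‖ ≤ ‖f d‖ ∧ ‖f d‖ ≤ M * ‖d‖)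
    (E₀ : Submodule ℝ E) (D₀ : Submodule ℝ D) (B₀ : Submodule ℝ B)
    [FiniteDimensional ℝ E₀] [FiniteDimensional ℝ D₀] [FiniteDimensional ℝ B₀] :
    ∃ r : Seminorm ℝ (E × B), r.FinRep X ∧ (∀ e ∈ E₀, r (e, 0) = ‖e‖) ∧
      (∀ b ∈ B₀, m * ‖b‖ ≤ r (0, b) ∧ r (0, b) ≤ M * ‖b‖) ∧
      ∀ d ∈ D₀, r (f d, -(d : B)) = 0 := by
  have hinj : Function.Injective f := by
    refine (injective_iff_map_eq_zero f).2 fun d hd => ?_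
    have := (hf d).1
    rw [hd, norm_zero] at this
    exact norm_le_zero_iff.1 (nonpos_of_mul_nonpos_right this hm)
  let e := Submodule.equivMapOfInjective f hinj D₀
  have hea : ∀ a : D₀.map f, f (e.symm a) = a := fun a => by
    rw [← Submodule.coe_equivMapOfInjective_apply f hinj D₀, LinearEquiv.apply_symm_apply]
  let E₁ : Submodule ℝ E := E₀ ⊔ D₀.map f
  let B₁ : Submodule ℝ B := B₀ ⊔ D₀.map D.subtype
  let i : D₀.map f →ₗ[ℝ] B₁ := LinearMap.codRestrict B₁
    (D.subtype ∘ₗ D₀.subtype ∘ₗ (e.symm : D₀.map f →ₗ[ℝ] D₀))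
    fun a => Submodule.mem_sup_right (Submodule.mem_map_of_mem (e.symm a).2)
  let k : D₀.map f →ₗ[ℝ] E₁ := Submodule.inclusion le_sup_right
  obtain ⟨r, hr, h1, h2, h3⟩ := hX.exists_seminorm_finiteDimensional (A := D₀.map f) (B := B₁)
    (E := E₁) (hE.submodule _) (hB.submodule _) (hE.submodule _) i k hm hmM
    (fun a => by
      have := hf (e.symm a)
      rw [hea] at this
      exact this) (fun a => rfl)
  obtain ⟨πE, hπE⟩ := E₁.subtype.exists_leftInverse_of_injective (Submodule.ker_subtype _)
  obtain ⟨πB, hπB⟩ := B₁.subtype.exists_leftInverse_of_injective (Submodule.ker_subtype _)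
  have hE' : ∀ x (hx : x ∈ E₁), πE x = ⟨x, hx⟩ := fun x hx => LinearMap.congr_fun hπE ⟨x, hx⟩
  have hB' : ∀ x (hx : x ∈ B₁), πB x = ⟨x, hx⟩ := fun x hx => LinearMap.congr_fun hπB ⟨x, hx⟩
  refine ⟨r.comp (πE.prodMap πB), hr.comp _, fun x hx => ?_, fun b hb => ?_, fun d hd => ?_⟩
  · simp only [Seminorm.comp_apply, LinearMap.prodMap_apply, map_zero]
    rw [hE' x (Submodule.mem_sup_left hx), h1]
    rfl
  · simp only [Seminorm.comp_apply, LinearMap.prodMap_apply, map_zero]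
    rw [hB' b (Submodule.mem_sup_left hb)]
    exact h2 ⟨b, _⟩
  · simp only [Seminorm.comp_apply, LinearMap.prodMap_apply, map_neg]
    have h4 : f d ∈ D₀.map f := Submodule.mem_map_of_mem hd
    have h5 : (d : B) ∈ D₀.map D.subtype := Submodule.mem_map_of_mem (f := D.subtype) hd
    rw [hE' _ (Submodule.mem_sup_right h4), hB' _ (Submodule.mem_sup_right h5)]
    have h6 := h3 ⟨f d, h4⟩
    have h7 : ((e.symm ⟨f d, h4⟩ : D₀) : D) = d := hinj (hea ⟨f d, h4⟩)
    have h8 : i ⟨f d, h4⟩ = ⟨(d : B), Submodule.mem_sup_right h5⟩ :=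
      Subtype.ext (congrArg (Subtype.val : D → B) h7)
    rwa [h8] at h6

/-- Amalgamation of spaces of arbitrary dimension, by a compactness argument. -/
theorem HasIsomorphicAmalgamation.exists_seminorm
    (hX : HasIsomorphicAmalgamation X) (hB : (normSeminorm ℝ B).FinRep X)
    (hE : (normSeminorm ℝ E).FinRep X) {D : Submodule ℝ B} (f : D →ₗ[ℝ] E) {m M : ℝ} (hm : 0 < m)
    (hmM : m ≤ M) (hf : ∀ d, m * ‖d‖ ≤ ‖f d‖ ∧ ‖f d‖ ≤ M * ‖d‖) :
    ∃ r : Seminorm ℝ (E × B), r.FinRep X ∧ (∀ e, r (e, 0) = ‖e‖) ∧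
      (∀ b, m * ‖b‖ ≤ r (0, b) ∧ r (0, b) ≤ M * ‖b‖) ∧ ∀ d, r (f d, -(d : B)) = 0 := by
  classical
  choose r hr h1 h2 h3 using fun s : Finset E × Finset D × Finset B =>
    hX.exists_seminorm_submodule hB hE f hm hmM hf (Submodule.span ℝ (s.1 : Set E))
      (Submodule.span ℝ (s.2.1 : Set D)) (Submodule.span ℝ (s.2.2 : Set B))
  -- Each clause of the conclusion concerns a single vector, hence holds for all large enough
  -- triples and survives in the limit.
  let l : Ultrafilter (Finset E × Finset D × Finset B) := Ultrafilter.of atTop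
  have hl : (l : Filter (Finset E × Finset D × Finset B)) ≤ atTop := Ultrafilter.of_le _
  have h1' : ∀ e, ∀ᶠ s in l, r s (e, 0) = ‖e‖ := fun e => by
    refine hl ?_
    filter_upwards [eventually_ge_atTop (({e}, ∅, ∅) : Finset E × Finset D × Finset B)] with s hs
    exact h1 s e (Submodule.subset_span (hs.1 (by simp)))
  have h2' : ∀ b, ∀ᶠ s in l, m * ‖b‖ ≤ r s (0, b) ∧ r s (0, b) ≤ M * ‖b‖ := fun b => by
    refine hl ?_
    filter_upwards [eventually_ge_atTop ((∅, ∅, {b}) : Finset E × Finset D × Finset B)] with s hs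
    exact h2 s b (Submodule.subset_span (hs.2.2 (by simp)))
  have h3' : ∀ d, ∀ᶠ s in l, r s (f d, -(d : B)) = 0 := fun d => by
    refine hl ?_
    filter_upwards [eventually_ge_atTop ((∅, {d}, ∅) : Finset E × Finset D × Finset B)] with s hs
    exact h3 s d (Submodule.subset_span (hs.2.1 (by simp)))
  obtain ⟨q, hq⟩ := Seminorm.exists_tendsto_of_bounded l r (by
    rintro ⟨e, b⟩
    refine ⟨‖e‖ + M * ‖b‖, ?_⟩
    filter_upwards [h1' e, h2' b] with s hs1 hs2
    have := map_add_le_add (r s) (e, 0) (0, b)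
    rw [Prod.mk_add_mk, add_zero, zero_add, hs1] at this
    linarith)
  refine ⟨q, Seminorm.FinRep.of_tendsto hq (Eventually.of_forall hr), fun e => ?_, fun b => ?_,
    fun d => ?_⟩
  · exact tendsto_nhds_unique (hq _) (tendsto_const_nhds.congr' ((h1' e).mono fun s hs => hs.symm))
  · exact ⟨ge_of_tendsto (hq _) ((h2' b).mono fun s hs => hs.1),
      le_of_tendsto (hq _) ((h2' b).mono fun s hs => hs.2)⟩
  · exact tendsto_nhds_unique (hq _) (tendsto_const_nhds.congr' ((h3' d).mono fun s hs => hs.symm))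

/-- A space that is finitely representable in an infinite-dimensional space has a proper extension
with the same property. -/
theorem Seminorm.FinRep.exists_proper_extension (hdim : ¬ FiniteDimensional ℝ X)
    (hE : (normSeminorm ℝ E).FinRep X) :
    ∃ p : Seminorm ℝ (E × ℝ), p.FinRep X ∧ (∀ e, p (e, 0) = ‖e‖) ∧ (∀ e, 1 ≤ p (e, 1)) ∧
      p (0, 1) ≤ 2 := by
  classical
  have key : ∀ s : Finset E × ℕ, ∃ r : Seminorm ℝ (E × ℝ), r.FinRep X ∧
      (∀ e ∈ s.1, ‖e‖ ≤ r (e, 0) ∧ r (e, 0) ≤ (1 + 1 / ((s.2 : ℝ) + 1)) * ‖e‖) ∧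
      (∀ e ∈ s.1, 1 ≤ r (e, 1)) ∧ r (0, 1) ≤ 2 := by
    rintro ⟨s, n⟩
    obtain ⟨T, hT⟩ := hE (Submodule.span ℝ (s : Set E)) inferInstance (1 / ((n : ℝ) + 1))
      (by positivity)
    set G : Submodule ℝ X := (Submodule.span ℝ (s : Set E)).map T with hG
    have hGtop : ∃ x, x ∉ G := by
      by_contra hcon
      push Not at hcon
      apply hdim
      have : G = ⊤ := (Submodule.eq_top_iff').2 hcon
      have hfd : FiniteDimensional ℝ G := by rw [hG]; infer_instance
      rw [this] at hfd
      exact Module.finite_def.2 (Module.Finite.iff_fg.1 hfd)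
    -- This is where infinite dimension enters: `G` is a proper closed subspace of `X`. Any `c`
    -- strictly between `1` and `R` would do.
    obtain ⟨b, hb2, hb⟩ := riesz_lemma_of_norm_lt (c := (3 / 2 : ℝ)) (by norm_num) (R := 2)
      (by norm_num) (F := G) G.closed_of_finiteDimensional hGtop
    refine ⟨(normSeminorm ℝ X).comp (LinearMap.coprod T (LinearMap.toSpanSingleton ℝ X b)),
      Seminorm.finRep_normSeminorm_self.comp _, fun e he => ?_, fun e he => ?_, ?_⟩
    · simpa [Seminorm.comp_apply] using hT e (Submodule.subset_span he)
    · have h4 := hb (-T e) (neg_mem (Submodule.mem_map_of_mem (Submodule.subset_span he)))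
      rw [sub_neg_eq_add, add_comm] at h4
      simpa [Seminorm.comp_apply] using h4
    · simpa [Seminorm.comp_apply] using hb2
  choose r hr h1 h2 h3 using key
  let l : Ultrafilter (Finset E × ℕ) := Ultrafilter.of atTop
  have hl : (l : Filter (Finset E × ℕ)) ≤ atTop := Ultrafilter.of_le _
  have hmem : ∀ e, ∀ᶠ s : Finset E × ℕ in l, e ∈ s.1 := fun e => by
    refine hl ?_
    filter_upwards [eventually_ge_atTop (({e}, 0) : Finset E × ℕ)] with s hs
    exact hs.1 (by simp)
  have h4 : Tendsto (fun s : Finset E × ℕ => 1 / ((s.2 : ℝ) + 1)) l (𝓝 0) := by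
    refine (tendsto_one_div_add_atTop_nhds_zero_nat.comp ?_).mono_left hl
    rw [← prod_atTop_atTop_eq]
    exact tendsto_snd
  have h5 : ∀ e, Tendsto (fun s => r s (e, 0)) l (𝓝 ‖e‖) := by
    intro e
    have h6 : Tendsto (fun s : Finset E × ℕ => (1 + 1 / ((s.2 : ℝ) + 1)) * ‖e‖) l (𝓝 ‖e‖) := by
      simpa using (h4.const_add 1).mul_const ‖e‖
    refine tendsto_of_tendsto_of_tendsto_of_le_of_le' tendsto_const_nhds h6 ?_ ?_
    · filter_upwards [hmem e] with s hs using (h1 s e hs).1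
    · filter_upwards [hmem e] with s hs using (h1 s e hs).2
  obtain ⟨q, hq⟩ := Seminorm.exists_tendsto_of_bounded l r (by
    rintro ⟨e, t⟩
    refine ⟨(‖e‖ + 1) + |t| * 2, ?_⟩
    filter_upwards [(h5 e).eventually_le_const (lt_add_one ‖e‖)] with s hs1
    have h6 := map_add_le_add (r s) (e, 0) (t • ((0 : E), (1 : ℝ)))
    rw [map_smul_eq_mul, Real.norm_eq_abs] at h6
    have h7 := mul_le_mul_of_nonneg_left (h3 s) (abs_nonneg t)
    simp only [Prod.smul_mk, smul_zero, smul_eq_mul, mul_one, Prod.mk_add_mk, add_zero,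
      zero_add] at h6
    linarith)
  refine ⟨q, Seminorm.FinRep.of_tendsto hq (Eventually.of_forall hr), fun e => ?_, fun e => ?_, ?_⟩
  · exact tendsto_nhds_unique (hq _) (h5 e)
  · exact ge_of_tendsto (hq _) ((hmem e).mono fun s hs => h2 s e hs)
  · exact le_of_tendsto (hq _) (Eventually.of_forall h3)

end Amalgamation

/-! ### Meeting requirements along a well-order -/

section Construction

variable {X : Type u} [NormedAddCommGroup X] [NormedSpace ℝ X] {I : Type u}

/-- The restriction of finitely supported functions to a set of coordinates. -/
noncomputable def supportRestriction (L : Set I) : (I →₀ ℝ) →ₗ[ℝ] (I →₀ ℝ) :=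
  open scoped Classical in
  (Finsupp.supported ℝ ℝ L).subtype ∘ₗ Finsupp.restrictDom ℝ ℝ L

theorem supportRestriction_mem (L : Set I) (v : I →₀ ℝ) :
    supportRestriction L v ∈ Finsupp.supported ℝ ℝ L := by
  classical
  exact (Finsupp.restrictDom ℝ ℝ L v).2

theorem supportRestriction_of_mem {L : Set I} {v : I →₀ ℝ} (hv : v ∈ Finsupp.supported ℝ ℝ L) :
    supportRestriction L v = v := by
  classical
  simp only [supportRestriction, LinearMap.comp_apply, Submodule.subtype_apply,
    Finsupp.restrictDom_apply]
  rw [Finsupp.filter_eq_self_iff]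
  exact fun i hi => hv (Finsupp.mem_support_iff.2 hi)

theorem supportRestriction_single {L : Set I} {i : I} (hi : i ∉ L) (t : ℝ) :
    supportRestriction L (Finsupp.single i t) = 0 := by
  classical
  simp only [supportRestriction, LinearMap.comp_apply, Submodule.subtype_apply,
    Finsupp.restrictDom_apply]
  exact Finsupp.filter_single_of_neg _ hi

variable [LinearOrder I]

/-- The requirement `P i` holds for `q`, unless it fails for all finitely representable seminorms
that agree with `q` on the coordinates below `i`. -/
def MeetsRequirement (X : Type u) [NormedAddCommGroup X] [NormedSpace ℝ X]
    (P : I → Seminorm ℝ (I →₀ ℝ) → Prop) (q : Seminorm ℝ (I →₀ ℝ)) (i : I) : Prop :=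
  (∃ r : Seminorm ℝ (I →₀ ℝ), r.FinRep X ∧
    (∀ v ∈ Finsupp.supported ℝ ℝ (Set.Iio i), r v = q v) ∧ P i r) → P i q

theorem MeetsRequirement.congr {P : I → Seminorm ℝ (I →₀ ℝ) → Prop}
    (hP : ∀ i q r, (∀ v ∈ Finsupp.supported ℝ ℝ (Set.Iic i), q v = r v) → P i q → P i r)
    {q r : Seminorm ℝ (I →₀ ℝ)} {i : I}
    (h : ∀ v ∈ Finsupp.supported ℝ ℝ (Set.Iic i), q v = r v) (hq : MeetsRequirement X P q i) :
    MeetsRequirement X P r i := by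
  rintro ⟨s, hs, hsr, hPs⟩
  refine hP i q r h (hq ⟨s, hs, fun v hv => ?_, hPs⟩)
  rw [hsr v hv, h v (Finsupp.supported_mono Set.Iio_subset_Iic_self hv)]

/-- A seminorm that meets the requirements attached to an initial segment of coordinates. -/
structure PartialSolution (X : Type u) [NormedAddCommGroup X] [NormedSpace ℝ X]
    (P : I → Seminorm ℝ (I →₀ ℝ) → Prop) where
  /-- the seminorm -/
  q : Seminorm ℝ (I →₀ ℝ)
  /-- the coordinates that have been treated -/
  L : LowerSet I
  finRep : q.FinRep X
  meets : ∀ i ∈ L, MeetsRequirement X P q i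

/-- Values on treated coordinates are frozen, all others may still change; hence only a preorder. -/
instance (P : I → Seminorm ℝ (I →₀ ℝ) → Prop) : Preorder (PartialSolution X P) where
  le a b := a.L ≤ b.L ∧ ∀ v ∈ Finsupp.supported ℝ ℝ (a.L : Set I), b.q v = a.q v
  le_refl a := ⟨le_rfl, fun _ _ => rfl⟩
  le_trans a b c hab hbc := ⟨hab.1.trans hbc.1, fun v hv => by
    rw [hbc.2 v (Finsupp.supported_mono hab.1 hv), hab.2 v hv]⟩

/-- On each vector supported in the union `L`, the seminorms of the chain are eventually constant.
Composing with `supportRestriction L` removes the arbitrary values off `L`, so an ultrafilter limit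
exists everywhere. -/
theorem PartialSolution.bddAbove_of_isChain {P : I → Seminorm ℝ (I →₀ ℝ) → Prop}
    (hP : ∀ i q r, (∀ v ∈ Finsupp.supported ℝ ℝ (Set.Iic i), q v = r v) → P i q → P i r)
    {c : Set (PartialSolution X P)} (hc : IsChain (· ≤ ·) c) (hne : c.Nonempty) :
    BddAbove c := by
  have : Nonempty c := hne.to_subtype
  have : IsDirectedOrder c := ⟨fun a b => by
    rcases hc.total a.2 b.2 with h | h
    · exact ⟨b, h, le_rfl⟩
    · exact ⟨a, le_rfl, h⟩⟩
  let L : LowerSet I := ⨆ a : c, (a : PartialSolution X P).L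
  have hL : ∀ a : c, (a : PartialSolution X P).L ≤ L := fun a =>
    le_iSup (fun a : c => (a : PartialSolution X P).L) a
  have hmemL : ∀ i ∈ L, ∃ a : c, i ∈ (a : PartialSolution X P).L := fun i hi => by
    simpa [L] using hi
  let l : Ultrafilter c := Ultrafilter.of atTop
  have hl : (l : Filter c) ≤ atTop := Ultrafilter.of_le _
  let r : c → Seminorm ℝ (I →₀ ℝ) := fun a =>
    (a : PartialSolution X P).q.comp (supportRestriction L)
  have hev : ∀ v ∈ Finsupp.supported ℝ ℝ (L : Set I),
      ∃ a : c, v ∈ Finsupp.supported ℝ ℝ ((a : PartialSolution X P).L : Set I) := by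
    intro v hv
    have : ∀ᶠ a : c in atTop, ∀ i ∈ v.support, i ∈ (a : PartialSolution X P).L := by
      rw [Finset.eventually_all]
      intro i hi
      obtain ⟨a, ha⟩ := hmemL i (hv hi)
      filter_upwards [eventually_ge_atTop a] with b hb using hb.1 ha
    exact this.exists
  have hlim : ∀ a : c, ∀ v ∈ Finsupp.supported ℝ ℝ ((a : PartialSolution X P).L : Set I),
      ∀ᶠ b in l, r b v = (a : PartialSolution X P).q v := by
    intro a v hv
    refine hl ?_
    filter_upwards [eventually_ge_atTop a] with b hb
    simp only [r, Seminorm.comp_apply]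
    rw [supportRestriction_of_mem (Finsupp.supported_mono (hL a) hv)]
    exact hb.2 v hv
  obtain ⟨q, hq⟩ := Seminorm.exists_tendsto_of_bounded l r (by
    intro v
    obtain ⟨a, ha⟩ := hev _ (supportRestriction_mem (L : Set I) v)
    refine ⟨(a : PartialSolution X P).q (supportRestriction L v), ?_⟩
    filter_upwards [hlim a _ ha] with b hb
    rw [← hb]
    simp only [r, Seminorm.comp_apply]
    rw [supportRestriction_of_mem (supportRestriction_mem (L : Set I) v)])
  have hqa : ∀ a : c, ∀ v ∈ Finsupp.supported ℝ ℝ ((a : PartialSolution X P).L : Set I),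
      q v = (a : PartialSolution X P).q v := fun a v hv =>
    tendsto_nhds_unique (hq v) (tendsto_const_nhds.congr' ((hlim a v hv).mono fun _ h => h.symm))
  refine ⟨⟨q, L, Seminorm.FinRep.of_tendsto hq (Eventually.of_forall fun a =>
    (a : PartialSolution X P).finRep.comp _), fun i hi => ?_⟩, fun a ha => ⟨hL ⟨a, ha⟩,
      hqa ⟨a, ha⟩⟩⟩
  obtain ⟨a, ha⟩ := hmemL i hi
  refine ((a : PartialSolution X P).meets i ha).congr hP fun v hv => (hqa a v ?_).symm
  exact Finsupp.supported_mono (fun j hj => (a : PartialSolution X P).L.lower hj ha) hv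

/-- Requirements on the coordinates of a well-ordered set can be met one after the other. -/
theorem exists_seminorm_meetsRequirement [WellFoundedLT I]
    {P : I → Seminorm ℝ (I →₀ ℝ) → Prop}
    (hP : ∀ i q r, (∀ v ∈ Finsupp.supported ℝ ℝ (Set.Iic i), q v = r v) → P i q → P i r) :
    ∃ q : Seminorm ℝ (I →₀ ℝ), q.FinRep X ∧ ∀ i, MeetsRequirement X P q i := by
  have h0 : (0 : Seminorm ℝ (I →₀ ℝ)).FinRep X := fun A _ ε _ => ⟨0, fun a _ => by simp⟩
  have : Nonempty (PartialSolution X P) := ⟨⟨0, ⊥, h0, fun i hi => by simp at hi⟩⟩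
  obtain ⟨m, hm⟩ := exists_maximal_of_nonempty_chains_bounded
    (fun (c : Set (PartialSolution X P)) hc hne =>
      PartialSolution.bddAbove_of_isChain hP hc hne) le_trans
  refine ⟨m.q, m.finRep, fun i => m.meets i ?_⟩
  by_contra hi
  have hne : {j | j ∉ m.L}.Nonempty := ⟨i, hi⟩
  obtain ⟨k, hk, hkmin⟩ := wellFounded_lt.has_min {j | j ∉ m.L} hne
  have hlt : ∀ j, j < k ↔ j ∈ m.L := by
    refine fun j => ⟨fun hj => ?_, fun hj => ?_⟩
    · by_contra hjL
      exact hkmin j hjL hj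
    · by_contra hjk
      exact hk (m.L.lower (not_lt.1 hjk) hj)
  have hL : (m.L : Set I) = Set.Iio k := Set.ext fun j => (hlt j).symm
  -- At the first untreated coordinate `k`, either some admissible seminorm meets the requirement
  -- and replaces the current one, or the requirement is vacuous.
  have hstep : ∃ q : Seminorm ℝ (I →₀ ℝ), q.FinRep X ∧
      (∀ v ∈ Finsupp.supported ℝ ℝ (Set.Iio k), q v = m.q v) ∧ MeetsRequirement X P q k := by
    by_cases h : ∃ r : Seminorm ℝ (I →₀ ℝ), r.FinRep X ∧
      (∀ v ∈ Finsupp.supported ℝ ℝ (Set.Iio k), r v = m.q v) ∧ P k r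
    · obtain ⟨r, hr, hrq, hPr⟩ := h
      exact ⟨r, hr, hrq, fun _ => hPr⟩
    · exact ⟨m.q, m.finRep, fun _ _ => rfl, fun h' => absurd h' h⟩
  obtain ⟨q, hq, hqm, hqk⟩ := hstep
  let m' : PartialSolution X P := ⟨q, LowerSet.Iic k, hq, fun j hj => by
    rcases (LowerSet.mem_Iic_iff.1 hj).lt_or_eq with hjk | rfl
    · refine (m.meets j ((hlt j).1 hjk)).congr hP fun v hv => (hqm v ?_).symm
      exact Finsupp.supported_mono (fun x hx => lt_of_le_of_lt hx hjk) hv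
    · exact hqk⟩
  have hmm' : m ≤ m' := ⟨fun j hj => LowerSet.mem_Iic_iff.2 ((hlt j).2 hj).le,
    fun v hv => hqm v (hL ▸ hv)⟩
  exact hk ((hm m' hmm').1 (LowerSet.mem_Iic_iff.2 le_rfl))

end Construction

/-! ### Cardinal arithmetic and the generic seminorm -/

section Counting

open Cardinal

variable {κ : Cardinal.{u}}

theorem Cardinal.IsRegular.exists_gt_of_mk_lt (hκ : κ.IsRegular) {s : Set κ.ord.ToType}
    (hs : #s < κ) : ∃ x, ∀ y ∈ s, y < x := by
  have h : ¬ IsCofinal s := fun h => by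
    have := Order.cof_le h
    rw [Ordinal.cof_toType, hκ.cof_ord] at this
    exact this.not_gt hs
  simpa [IsCofinal] using h

theorem IsStarCardinal.two_power_le (hκ : IsStarCardinal κ) {τ : Cardinal.{u}} (hτ : τ < κ) :
    2 ^ τ ≤ κ := by
  have hb : BddAbove (Set.range fun τ : Set.Iio κ => (2 : Cardinal.{u}) ^ (τ : Cardinal.{u})) := by
    refine ⟨2 ^ κ, ?_⟩
    rintro _ ⟨τ, rfl⟩
    exact power_le_power_left two_ne_zero (le_of_lt τ.2)
  have h := le_ciSup hb ⟨τ, hτ⟩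
  rwa [← hκ.2] at h

theorem Cardinal.mk_Iio_toType_lt (x : κ.ord.ToType) : #(Set.Iio x) < κ := by
  simpa using mk_Iio_lt x (by simp)

/-- A set of cardinality at most a star-cardinal `κ` has at most `κ` subsets of cardinality less
than `κ`. -/
theorem IsStarCardinal.mk_small_subsets_le (hκ : IsStarCardinal κ) {Z : Type u} (hZ : #Z ≤ κ) :
    #{G : Set Z // #G < κ} ≤ κ := by
  have hI : #κ.ord.ToType = κ := by simp
  rw [← hI] at hZ
  obtain ⟨e⟩ := (le_def _ _).1 hZ
  have hb : ∀ G : {G : Set Z // #G < κ}, ∃ x, ∀ y ∈ e '' (G : Set Z), y < x := fun G =>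
    hκ.1.exists_gt_of_mk_lt (mk_image_le.trans_lt G.2)
  choose b hb using hb
  -- By regularity a small set is bounded, so it is coded by a bound `x` and a subset of `Set.Iio
  -- x`; there are at most `κ` bounds, each with at most `κ` subsets.
  let F : {G : Set Z // #G < κ} → Σ x : κ.ord.ToType, Set (Set.Iio x) := fun G =>
    ⟨b G, {y | (y : κ.ord.ToType) ∈ e '' (G : Set Z)}⟩
  have hF : ∀ (G : {G : Set Z // #G < κ}) (z : Z), z ∈ (G : Set Z) ↔ ∃ y ∈ (F G).2, (y : κ.ord.ToType) = e z := by
    refine fun G z => ⟨fun hz => ⟨⟨e z, hb G _ ⟨z, hz, rfl⟩⟩, ⟨z, hz, rfl⟩, rfl⟩, ?_⟩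
    rintro ⟨y, ⟨z', hz', hy⟩, hyz⟩
    rw [hyz] at hy
    rwa [← e.injective hy]
  have hFinj : Function.Injective F := fun G G' h => by
    refine Subtype.ext (Set.ext fun z => ?_)
    rw [hF, hF, h]
  refine (mk_le_of_injective hFinj).trans ?_
  rw [mk_sigma]
  refine (sum_le_sum _ (fun _ => κ) fun x => ?_).trans ?_
  · rw [mk_set]
    exact hκ.two_power_le (mk_Iio_toType_lt x)
  · rw [sum_const', hI, mul_eq_self hκ.1.aleph0_le]

/-- A finitely representable seminorm on a space of algebraic dimension `κ` that realizes all small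
sets of conditions that are satisfiable in a finitely representable extension. -/
theorem IsStarCardinal.exists_saturated_seminorm (hκ : IsStarCardinal κ)
    (X : Type u) [NormedAddCommGroup X] [NormedSpace ℝ X] :
    ∃ q : Seminorm ℝ (κ.ord.ToType →₀ ℝ), q.FinRep X ∧
      ∀ G : Set ((κ.ord.ToType →₀ ℚ) × ℚ × ℚ), #G < κ →
      ∀ p : Seminorm ℝ ((κ.ord.ToType →₀ ℝ) × ℝ),
      Seminorm.FinRep (V := (κ.ord.ToType →₀ ℝ) × ℝ) p X → (∀ v, p (v, 0) = q v) →
      (∀ g ∈ G, (g.2.1 : ℝ) ≤ p (g.1.mapRange (Rat.cast : ℚ → ℝ) Rat.cast_zero, 1) ∧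
        p (g.1.mapRange (Rat.cast : ℚ → ℝ) Rat.cast_zero, 1) ≤ (g.2.2 : ℝ)) →
      ∃ x, ∀ g ∈ G, (g.2.1 : ℝ) ≤ q (x + g.1.mapRange (Rat.cast : ℚ → ℝ) Rat.cast_zero) ∧
        q (x + g.1.mapRange (Rat.cast : ℚ → ℝ) Rat.cast_zero) ≤ (g.2.2 : ℝ) := by
  let I := κ.ord.ToType
  let Z := (I →₀ ℚ) × ℚ × ℚ
  let cst : (I →₀ ℚ) → (I →₀ ℝ) := Finsupp.mapRange (Rat.cast : ℚ → ℝ) Rat.cast_zero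
  have hcst : ∀ (s : I →₀ ℚ) (L : Set I), (s.support : Set I) ⊆ L →
      cst s ∈ Finsupp.supported ℝ ℝ L := fun s L h =>
    (Finset.coe_subset.2 Finsupp.support_mapRange).trans h
  have hI : #I = κ := by simp [I]
  have hinf : Infinite I := infinite_iff.2 (hI ▸ hκ.1.aleph0_le)
  have hZ : #Z ≤ κ := by
    have h1 : #(I →₀ ℚ) = κ := by
      rw [mk_finsupp_lift_of_infinite, lift_uzero, hI]
      simp [hκ.1.aleph0_le]
    simp only [Z, mk_prod, h1, lift_id, lift_uzero]
    simp [hκ.1.aleph0_le]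
  let T := {G : Set Z // #G < κ}
  have hT : #(T × I) ≤ #I := by
    rw [mk_prod, lift_id, lift_id, hI]
    exact (mul_le_mul' (hκ.mk_small_subsets_le hZ) le_rfl).trans (mul_eq_self hκ.1.aleph0_le).le
  have : Nonempty (T × I) := ⟨⟨⟨∅, by simpa using hκ.1.pos⟩, Classical.arbitrary I⟩⟩
  obtain ⟨j⟩ := (le_def _ _).1 hT
  let t : I → T × I := Function.invFun j
  have ht : Function.Surjective t := Function.invFun_surjective j.injective
  -- The fibre of `t` over `G` has `κ` elements, too many for a proper initial segment.
  have hunb : ∀ (G : T) (x : I), ∃ i, x < i ∧ (t i).1 = G := by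
    intro G x
    by_contra hcon
    push Not at hcon
    obtain ⟨x', hx'⟩ := hκ.1.exists_gt_of_mk_lt (s := {x})
      (by simpa using hκ.1.nat_lt 1)
    have hsub : {i | (t i).1 = G} ⊆ Set.Iio x' := fun i hi =>
      lt_of_le_of_lt (not_lt.1 fun h => hcon i h hi) (hx' x rfl)
    have h1 : #{i | (t i).1 = G} < κ := (mk_le_mk_of_subset hsub).trans_lt (mk_Iio_toType_lt x')
    have h2 : #I ≤ #{i | (t i).1 = G} := by
      choose k hk using fun y : I => ht (G, y)
      refine mk_le_of_injective (f := fun y => (⟨k y, by simp [hk]⟩ : {i | (t i).1 = G})) ?_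
      intro y y' hy
      have := hk y
      have hkk : k y = k y' := congrArg Subtype.val hy
      rw [hkk, hk y'] at this
      simpa using this.symm
    exact (hI ▸ h2).not_gt h1
  -- Conditions whose parameters are not below `i` are ignored, so that `P i` depends only on
  -- coordinates up to `i`.
  let P : I → Seminorm ℝ (I →₀ ℝ) → Prop := fun i r =>
    ∀ g ∈ ((t i).1 : Set Z), (g.1.support : Set I) ⊆ Set.Iio i →
      (g.2.1 : ℝ) ≤ r (Finsupp.single i 1 + cst g.1) ∧
        r (Finsupp.single i 1 + cst g.1) ≤ (g.2.2 : ℝ)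
  have hP : ∀ i q r, (∀ v ∈ Finsupp.supported ℝ ℝ (Set.Iic i), q v = r v) → P i q → P i r := by
    intro i q r h hq g hg hgi
    rw [← h]
    · exact hq g hg hgi
    · refine add_mem (Finsupp.single_mem_supported ℝ 1 (by simp)) (hcst _ _ ?_)
      exact hgi.trans Set.Iio_subset_Iic_self
  obtain ⟨q, hq, hreq⟩ := exists_seminorm_meetsRequirement (X := X) hP
  refine ⟨q, hq, fun G hG p hp hpq hpG => ?_⟩
  have hb : ∀ g : Z, ∃ x, ∀ y ∈ (g.1.support : Set I), y < x := fun g =>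
    hκ.1.exists_gt_of_mk_lt ((lt_aleph0_of_finite _).trans_le hκ.1.aleph0_le)
  choose b hb using hb
  obtain ⟨x, hx⟩ := hκ.1.exists_gt_of_mk_lt (s := b '' G) (mk_image_le.trans_lt hG)
  obtain ⟨i, hxi, hi⟩ := hunb ⟨G, hG⟩ x
  have hsupp : ∀ g ∈ G, (g.1.support : Set I) ⊆ Set.Iio i := fun g hg y hy =>
    (hb g y hy).trans ((hx _ ⟨g, hg, rfl⟩).trans hxi)
  -- Coordinate `i` becomes the added dimension and later coordinates are killed; `p.comp f` then
  -- witnesses that the requirement at `i` is satisfiable.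
  let f : (I →₀ ℝ) →ₗ[ℝ] (I →₀ ℝ) × ℝ := (supportRestriction (Set.Iio i)).prod (Finsupp.lapply i)
  have hfs : ∀ v ∈ Finsupp.supported ℝ ℝ (Set.Iio i), f v = (v, 0) := by
    intro v hv
    simp only [f, LinearMap.prod_apply, Function.prod_apply, supportRestriction_of_mem hv,
      Finsupp.lapply_apply, Prod.mk.injEq, true_and]
    by_contra h0
    exact lt_irrefl i (hv (Finsupp.mem_support_iff.2 h0))
  have hfi : f (Finsupp.single i 1) = (0, 1) := by
    have := supportRestriction_single (L := Set.Iio i) (lt_irrefl i) 1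
    simp [f, this]
  have hf : ∀ g ∈ G, f (Finsupp.single i 1 + cst g.1) = (cst g.1, 1) := fun g hg => by
    rw [map_add, hfi, hfs _ (hcst _ _ (hsupp g hg))]
    simp
  have hPq : P i q := by
    refine hreq i ⟨p.comp f, hp.comp f, fun v hv => ?_, fun g hg hgi => ?_⟩
    · rw [Seminorm.comp_apply, hfs v hv, hpq]
    · rw [hi] at hg
      rw [Seminorm.comp_apply, hf g hg]
      exact hpG g hg
  refine ⟨Finsupp.single i 1, fun g hg => hPq g ?_ (hsupp g hg)⟩
  rw [hi]
  exact hg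

end Counting

/-! ### Realizing one-dimensional extensions; dense sets and dimension -/

section Saturation

open Cardinal

/-- The space `E` realizes, up to prescribed errors, the norms of the vectors `x + e`, for fewer than
`κ` points `e` of `E`, where `x` is a vector of a one-dimensional extension of `E` that is finitely
representable in `X`. -/
def RealizesExtensions (E X : Type u) [NormedAddCommGroup E] [NormedSpace ℝ E]
    [NormedAddCommGroup X] [NormedSpace ℝ X] (κ : Cardinal.{u}) : Prop :=
  ∀ p : Seminorm ℝ (E × ℝ), p.FinRep X → (∀ e, p (e, 0) = ‖e‖) →
    ∀ F : Set (E × ℝ), #F < κ → (∀ g ∈ F, 0 < g.2) →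
      ∃ x : E, ∀ g ∈ F, |‖x + g.1‖ - p (g.1, 1)| ≤ g.2

theorem Seminorm.exists_rat_approx {I : Type*} (q : Seminorm ℝ (I →₀ ℝ)) (v : I →₀ ℝ) {δ : ℝ}
    (hδ : 0 < δ) :
    ∃ s : I →₀ ℚ, q (v - s.mapRange (Rat.cast : ℚ → ℝ) Rat.cast_zero) < δ := by
  induction v using Finsupp.induction_linear generalizing δ with
  | zero => exact ⟨0, by simpa using hδ⟩
  | add v w hv hw =>
    obtain ⟨s, hs⟩ := hv (half_pos hδ)
    obtain ⟨t, ht⟩ := hw (half_pos hδ)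
    refine ⟨s + t, ?_⟩
    rw [Finsupp.mapRange_add Rat.cast_add, add_sub_add_comm]
    exact (map_add_le_add q _ _).trans_lt (by linarith)
  | single i c =>
    have hq : 0 < q (Finsupp.single i 1) + 1 := by linarith [apply_nonneg q (Finsupp.single i 1)]
    obtain ⟨t, ht1, ht2⟩ := exists_rat_btwn (show c < c + δ / (q (Finsupp.single i 1) + 1) by
      linarith [div_pos hδ hq])
    refine ⟨Finsupp.single i t, ?_⟩
    rw [Finsupp.mapRange_single, ← Finsupp.single_sub, ← mul_one (c - t), ← smul_eq_mul,
      ← Finsupp.smul_single, map_smul_eq_mul, Real.norm_eq_abs, abs_sub_comm, abs_of_pos (by linarith)]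
    have h1 : (t - c) * (q (Finsupp.single i 1) + 1) < δ := by
      rw [← lt_div_iff₀ hq]
      linarith
    nlinarith

/-- Every seminormed real vector space embeds isometrically as a dense part of a Banach space. -/
theorem Seminorm.exists_completion {V : Type u} [AddCommGroup V] [Module ℝ V]
    (q : Seminorm ℝ V) :
    ∃ (E : Type u) (_ : NormedAddCommGroup E) (_ : NormedSpace ℝ E),
      CompleteSpace E ∧ ∃ i : V →ₗ[ℝ] E, (∀ v, ‖i v‖ = q v) ∧ DenseRange i := by
  let _ : SeminormedAddCommGroup V := q.toAddGroupSeminorm.toSeminormedAddCommGroup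
  have hn : ∀ v : V, ‖v‖ = q v := fun v => rfl
  let _ : NormedSpace ℝ V := ⟨fun c v => by rw [hn, hn, map_smul_eq_mul]⟩
  refine ⟨UniformSpace.Completion V, inferInstance, inferInstance, inferInstance,
    (UniformSpace.Completion.toComplₗᵢ (𝕜 := ℝ) (E := V)).toLinearMap, fun v => ?_, ?_⟩
  · exact (UniformSpace.Completion.norm_coe v).trans (hn v)
  · exact UniformSpace.Completion.denseRange_coe

/-- Approximating a basis of a finite-dimensional `A` from the dense range gives linear maps `A → V`
along which the pull-backs of `q` converge to the norm of `A`. -/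
theorem Seminorm.FinRep.of_denseRange {V E X : Type*} [AddCommGroup V] [Module ℝ V]
    [NormedAddCommGroup E] [NormedSpace ℝ E] [NormedAddCommGroup X] [NormedSpace ℝ X]
    {q : Seminorm ℝ V} (hq : q.FinRep X) {i : V →ₗ[ℝ] E} (hi : ∀ v, ‖i v‖ = q v)
    (hd : DenseRange i) : (normSeminorm ℝ E).FinRep X := by
  intro A hA ε hε
  have h1 : ∀ (n : ℕ) (e : E), ∃ v, ‖i v - e‖ < 1 / ((n : ℝ) + 1) := fun n e => by
    obtain ⟨v, hv⟩ := hd.exists_dist_lt e (show 0 < 1 / ((n : ℝ) + 1) by positivity)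
    exact ⟨v, by rwa [dist_comm, dist_eq_norm] at hv⟩
  choose w hw using h1
  let b := Module.finBasis ℝ A
  let L : ℕ → A →ₗ[ℝ] V := fun n => b.constr ℝ fun k => w n (b k)
  have hL : ∀ a : A, Tendsto (fun n => i (L n a)) atTop (𝓝 (a : E)) := by
    intro a
    have h2 : ∀ e : E, Tendsto (fun n => i (w n e)) atTop (𝓝 e) := fun e => by
      rw [tendsto_iff_norm_sub_tendsto_zero]
      exact squeeze_zero (fun _ => norm_nonneg _) (fun n => (hw n e).le)
        tendsto_one_div_add_atTop_nhds_zero_nat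
    have h3 : (a : E) = ∑ k, b.repr a k • (b k : E) := by
      calc (a : E) = A.subtype (∑ k, b.repr a k • b k) := by rw [b.sum_repr]; rfl
        _ = _ := by rw [map_sum]; rfl
    rw [h3]
    simp only [L, Module.Basis.constr_apply_fintype, map_sum, map_smul]
    exact tendsto_finsetSum _ fun k _ => (h2 (b k)).const_smul _
  have hA' : (normSeminorm ℝ A).FinRep X := by
    refine Seminorm.FinRep.of_tendsto (l := atTop) (r := fun n => q.comp (L n)) (fun a => ?_)
      (Eventually.of_forall fun n => hq.comp _)
    simp only [Seminorm.comp_apply, ← hi]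
    exact (hL a).norm
  obtain ⟨T, hT⟩ := hA' ⊤ inferInstance ε hε
  obtain ⟨S, hS⟩ := LinearMap.exists_extend T
  refine ⟨S, fun a ha => ?_⟩
  rw [show S a = T ⟨a, ha⟩ from LinearMap.congr_fun hS ⟨a, ha⟩]
  exact hT ⟨a, ha⟩ trivial

theorem banachDim_le {E : Type u} [NormedAddCommGroup E] [NormedSpace ℝ E] {s : Set E}
    (hs : (Submodule.span ℝ s).topologicalClosure = ⊤) : banachDim E ≤ #s :=
  csInf_le' ⟨s, hs, rfl⟩

theorem exists_mk_eq_banachDim (E : Type u) [NormedAddCommGroup E] [NormedSpace ℝ E] :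
    ∃ s : Set E, (Submodule.span ℝ s).topologicalClosure = ⊤ ∧ #s = banachDim E :=
  csInf_mem (s := {c | ∃ s : Set E, (Submodule.span ℝ s).topologicalClosure = ⊤ ∧ #s = c})
    ⟨_, Set.univ, top_le_iff.1 (by rw [Submodule.span_univ]; exact Submodule.le_topologicalClosure _),
      rfl⟩

/-- There is a Banach space of dimension at most `κ`, finitely representable in `X`, that realizes
one-dimensional extensions. -/
theorem IsStarCardinal.exists_realizesExtensions {κ : Cardinal.{u}} (hκ : IsStarCardinal κ)
    (X : Type u) [NormedAddCommGroup X] [NormedSpace ℝ X] :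
    ∃ (E : Type u) (_ : NormedAddCommGroup E) (_ : NormedSpace ℝ E),
      CompleteSpace E ∧ (normSeminorm ℝ E).FinRep X ∧ banachDim E ≤ κ ∧
        RealizesExtensions E X κ := by
  obtain ⟨q, hq, hsat⟩ := hκ.exists_saturated_seminorm X
  obtain ⟨E, _, _, hE, i, hi, hd⟩ := q.exists_completion
  refine ⟨E, _, _, hE, hq.of_denseRange hi hd, ?_, fun p hp hpE F hF hpos => ?_⟩
  · let s : Set E := Set.range fun k : κ.ord.ToType => i (Finsupp.single k 1)
    refine (banachDim_le (s := s) ?_).trans (mk_range_le.trans (by simp))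
    rw [← Submodule.dense_iff_topologicalClosure_eq_top]
    refine hd.mono ?_
    rintro _ ⟨v, rfl⟩
    induction v using Finsupp.induction_linear with
    | zero => simp
    | add v w hv hw => rw [map_add]; exact add_mem hv hw
    | single k c =>
      rw [← mul_one c, ← smul_eq_mul, ← Finsupp.smul_single, map_smul]
      exact Submodule.smul_mem _ _ (Submodule.subset_span ⟨k, rfl⟩)
  · let cst : (κ.ord.ToType →₀ ℚ) → (κ.ord.ToType →₀ ℝ) :=
      Finsupp.mapRange (Rat.cast : ℚ → ℝ) Rat.cast_zero
    have happ : ∀ (e : E) (δ : ℝ), 0 < δ → ∃ s, ‖i (cst s) - e‖ < δ := by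
      intro e δ hδ
      obtain ⟨v, hv⟩ := hd.exists_dist_lt e (half_pos hδ)
      obtain ⟨s, hs⟩ := q.exists_rat_approx v (half_pos hδ)
      refine ⟨s, ?_⟩
      rw [dist_eq_norm] at hv
      rw [← hi, map_sub] at hs
      rw [norm_sub_rev]
      have := norm_sub_le_norm_sub_add_norm_sub e (i v) (i (cst s))
      exact this.trans_lt (by linarith)
    -- The tolerance is split in three: moving to a rational vector changes both the norm in `E` and
    -- `p` by less than a third, and the rational interval around the value of `p` uses the last
    -- third.
    have hex : ∀ g : E × ℝ, ∃ h : (κ.ord.ToType →₀ ℚ) × ℚ × ℚ, g ∈ F →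
        ‖i (cst h.1) - g.1‖ < g.2 / 3 ∧ p (i (cst h.1), 1) - g.2 / 3 < h.2.1 ∧
        (h.2.1 : ℝ) < p (i (cst h.1), 1) ∧ p (i (cst h.1), 1) < h.2.2 ∧
        (h.2.2 : ℝ) < p (i (cst h.1), 1) + g.2 / 3 := by
      intro g
      by_cases hg : g ∈ F
      · have hg0 := hpos g hg
        obtain ⟨s, hs⟩ := happ g.1 (g.2 / 3) (by linarith)
        obtain ⟨a, ha1, ha2⟩ := exists_rat_btwn (show p (i (cst s), 1) - g.2 / 3 < p (i (cst s), 1) by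
          linarith)
        obtain ⟨b, hb1, hb2⟩ := exists_rat_btwn (show p (i (cst s), 1) < p (i (cst s), 1) + g.2 / 3 by
          linarith)
        exact ⟨⟨s, a, b⟩, fun _ => ⟨hs, ha1, ha2, hb1, hb2⟩⟩
      · exact ⟨0, fun h => absurd h hg⟩
    choose h hh using hex
    obtain ⟨x, hx⟩ := hsat (h '' F) (mk_image_le.trans_lt hF)
      (p.comp (i.prodMap LinearMap.id)) (hp.comp _)
      (fun v => by simp [Seminorm.comp_apply, hpE, hi]) (by
        rintro _ ⟨g, hg, rfl⟩
        exact ⟨(hh g hg).2.2.1.le, (hh g hg).2.2.2.1.le⟩)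
    refine ⟨i x, fun g hg => ?_⟩
    obtain ⟨h1, h2⟩ := hx _ ⟨g, hg, rfl⟩
    obtain ⟨h3, h4, -, -, h5⟩ := hh g hg
    rw [← hi, map_add] at h1 h2
    change ‖i x + i (cst (h g).1)‖ ≤ _ at h2
    change _ ≤ ‖i x + i (cst (h g).1)‖ at h1
    have h6 : |‖i x + g.1‖ - ‖i x + i (cst (h g).1)‖| ≤ ‖i (cst (h g).1) - g.1‖ := by
      refine (abs_norm_sub_norm_le _ _).trans ?_
      rw [add_sub_add_left_eq_sub, norm_sub_rev]
    have h7 : |p (i (cst (h g).1), 1) - p (g.1, 1)| ≤ ‖i (cst (h g).1) - g.1‖ := by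
      refine (abs_sub_map_le_sub p _ _).trans ?_
      rw [Prod.mk_sub_mk, sub_self, hpE]
    rw [abs_le] at h6 h7 ⊢
    constructor <;> linarith [h6.1, h6.2, h7.1, h7.2]

/-- A Banach space has a dense subset whose cardinality is its dimension, unless the latter is
finite. -/
theorem exists_dense_mk_le (B : Type u) [NormedAddCommGroup B] [NormedSpace ℝ B] :
    ∃ s : Set B, Dense s ∧ #s ≤ max (banachDim B) ℵ₀ := by
  obtain ⟨s, hs, hsc⟩ := exists_mk_eq_banachDim B
  let φ : (s →₀ ℝ) →ₗ[ℝ] B := Finsupp.linearCombination ℝ (Subtype.val : s → B)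
  let f : (s →₀ ℚ) → B := fun l => φ (l.mapRange (Rat.cast : ℚ → ℝ) Rat.cast_zero)
  refine ⟨Set.range f, ?_, mk_range_le.trans ?_⟩
  · rw [← Submodule.dense_iff_topologicalClosure_eq_top] at hs
    refine dense_closure.1 (hs.mono fun v hv => ?_)
    rw [← Subtype.range_coe (s := s), ← Finsupp.range_linearCombination] at hv
    obtain ⟨l, rfl⟩ := hv
    refine Metric.mem_closure_iff.2 fun ε hε => ?_
    obtain ⟨t, ht⟩ := ((normSeminorm ℝ B).comp φ).exists_rat_approx l hε
    refine ⟨f t, ⟨t, rfl⟩, ?_⟩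
    rw [dist_eq_norm]
    simpa [Seminorm.comp_apply] using ht
  · rw [← hsc]
    rcases isEmpty_or_nonempty s with he | hne
    · exact (mk_le_aleph0).trans (le_max_right _ _)
    · simp

/-- Subspaces of a Banach space have dense subsets that are no larger than those of the space. -/
theorem exists_dense_subset_submodule {B : Type u} [NormedAddCommGroup B] [NormedSpace ℝ B]
    {s : Set B} (hs : Dense s) (D : Submodule ℝ B) :
    ∃ t : Set D, Dense t ∧ #t ≤ #s * ℵ₀ := by
  have h : ∀ g : s × ULift.{u} ℕ, ∃ d : D, (∃ d' : D, ‖(d' : B) - g.1‖ < 1 / ((g.2.down : ℝ) + 1)) →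
      ‖(d : B) - g.1‖ < 1 / ((g.2.down : ℝ) + 1) := by
    intro g
    by_cases hg : ∃ d' : D, ‖(d' : B) - g.1‖ < 1 / ((g.2.down : ℝ) + 1)
    · exact ⟨hg.choose, fun _ => hg.choose_spec⟩
    · exact ⟨0, fun h => absurd h hg⟩
  choose f hf using h
  refine ⟨Set.range f, Metric.dense_iff.2 fun d ε hε => ?_, mk_range_le.trans (by simp)⟩
  obtain ⟨n, hn⟩ := exists_nat_one_div_lt (half_pos hε)
  obtain ⟨y, hy, hyd⟩ := hs.exists_dist_lt (d : B) (show 0 < 1 / ((n : ℝ) + 1) by positivity)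
  rw [dist_eq_norm] at hyd
  refine ⟨f (⟨y, hy⟩, ⟨n⟩), ?_, ⟨_, rfl⟩⟩
  have h1 := hf (⟨y, hy⟩, ⟨n⟩) ⟨d, hyd⟩
  simp only at h1
  rw [Metric.mem_ball, dist_eq_norm]
  change ‖(f (⟨y, hy⟩, ⟨n⟩) : B) - d‖ < ε
  have h2 := norm_sub_le_norm_sub_add_norm_sub (f (⟨y, hy⟩, ⟨n⟩) : B) y d
  rw [norm_sub_rev y] at h2
  linarith

theorem finiteDimensional_of_banachDim_lt_aleph0 {B : Type u} [NormedAddCommGroup B]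
    [NormedSpace ℝ B] (h : banachDim B < ℵ₀) : FiniteDimensional ℝ B := by
  obtain ⟨s, hs, hsc⟩ := exists_mk_eq_banachDim B
  rw [← hsc, lt_aleph0_iff_set_finite] at h
  have : FiniteDimensional ℝ (Submodule.span ℝ s) := FiniteDimensional.span_of_finite ℝ h
  rw [(Submodule.closed_of_finiteDimensional _).submodule_topologicalClosure_eq] at hs
  exact ⟨⟨h.toFinset, by simpa using hs⟩⟩

theorem banachDim_lt_aleph0 (B : Type u) [NormedAddCommGroup B] [NormedSpace ℝ B]
    [FiniteDimensional ℝ B] : banachDim B < ℵ₀ := by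
  obtain ⟨s, hs⟩ := Module.Finite.fg_top (R := ℝ) (M := B)
  refine (banachDim_le (s := (s : Set B)) ?_).trans_lt (lt_aleph0_of_finite _)
  rw [hs]
  exact top_le_iff.1 (Submodule.le_topologicalClosure _)

end Saturation

/-! ### Extending embeddings vector by vector -/

section Extension

open Cardinal

variable {X B E : Type u} [NormedAddCommGroup X] [NormedSpace ℝ X]
  [NormedAddCommGroup B] [NormedSpace ℝ B] [NormedAddCommGroup E] [NormedSpace ℝ E]

/-- A partial linear map whose operator norm is at most `M` and whose inverse has norm at most
`m⁻¹`. -/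
def LinearPMap.IsBoundedBetween (g : B →ₗ.[ℝ] E) (m M : ℝ) : Prop :=
  ∀ d : g.domain, m * ‖(d : B)‖ ≤ ‖g d‖ ∧ ‖g d‖ ≤ M * ‖(d : B)‖

theorem LinearPMap.IsBoundedBetween.exists_extension {g : B →ₗ.[ℝ] E} {m M : ℝ} {b : B}
    (hb : b ∉ g.domain) {x : E} (hx : ∀ (d : g.domain) (t : ℝ),
      m * ‖(d : B) + t • b‖ ≤ ‖g d + t • x‖ ∧ ‖g d + t • x‖ ≤ M * ‖(d : B) + t • b‖) :
    ∃ g' : B →ₗ.[ℝ] E, g ≤ g' ∧ b ∈ g'.domain ∧ g'.IsBoundedBetween m M := by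
  refine ⟨g.supSpanSingleton b x hb, LinearPMap.left_le_sup _ _ _,
    Submodule.mem_sup_right (Submodule.mem_span_singleton_self b), ?_⟩
  rintro ⟨y, hy⟩
  obtain ⟨d, hd, z, hz, rfl⟩ := Submodule.mem_sup.1 hy
  obtain ⟨t, rfl⟩ := Submodule.mem_span_singleton.1 hz
  rw [LinearPMap.supSpanSingleton_apply_mk g b x hb d hd t]
  exact hx ⟨d, hd⟩ t

/-- In the amalgam `g d` and `d` are identified, so `(g d, t • b)` has the seminorm of `(0, d + t •
b)`, and the bounds on the `B`-leg apply. -/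
theorem HasIsomorphicAmalgamation.exists_seminorm_prod_real
    (hX : HasIsomorphicAmalgamation X) (hB : (normSeminorm ℝ B).FinRep X)
    (hE : (normSeminorm ℝ E).FinRep X) {g : B →ₗ.[ℝ] E} {m M : ℝ} (hm : 0 < m)
    (hmM : m ≤ M) (hg : g.IsBoundedBetween m M) (b : B) :
    ∃ p : Seminorm ℝ (E × ℝ), p.FinRep X ∧ (∀ e, p (e, 0) = ‖e‖) ∧
      ∀ (d : g.domain) (t : ℝ), m * ‖(d : B) + t • b‖ ≤ p (g d, t) ∧
        p (g d, t) ≤ M * ‖(d : B) + t • b‖ := by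
  obtain ⟨r, hr, h1, h2, h3⟩ := hX.exists_seminorm hB hE g.toFun hm hmM hg
  refine ⟨r.comp (LinearMap.id.prodMap (LinearMap.toSpanSingleton ℝ B b)), hr.comp _,
    fun e => by simpa [Seminorm.comp_apply] using h1 e, fun d t => ?_⟩
  have h4 : r (g d, t • b) = r (0, (d : B) + t • b) := by
    apply r.eq_of_sub_eq_zero
    have : ((g d, t • b) : E × B) - (0, (d : B) + t • b) = (g d, -(d : B)) := by
      simp
    rw [this]
    exact h3 d
  simp only [Seminorm.comp_apply, LinearMap.prodMap_apply, LinearMap.id_apply,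
    LinearMap.toSpanSingleton_apply, h4]
  exact h2 _

/-- One-step extension without loss, for uncountable `κ`. -/
theorem RealizesExtensions.exists_extension_of_aleph0_lt {κ : Cardinal.{u}}
    (hreal : RealizesExtensions E X κ) (hκ : ℵ₀ < κ) (hX : HasIsomorphicAmalgamation X)
    (hB : (normSeminorm ℝ B).FinRep X) (hE : (normSeminorm ℝ E).FinRep X)
    (hdim : banachDim B < κ) {g : B →ₗ.[ℝ] E} {m M : ℝ} (hm : 0 < m)
    (hmM : m ≤ M) (hg : g.IsBoundedBetween m M) {b : B} (hb : b ∉ g.domain) :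
    ∃ g' : B →ₗ.[ℝ] E, g ≤ g' ∧ b ∈ g'.domain ∧ g'.IsBoundedBetween m M := by
  obtain ⟨p, hp, hpE, hpb⟩ := hX.exists_seminorm_prod_real hB hE hm hmM hg b
  obtain ⟨s, hs, hsc⟩ := exists_dense_mk_le B
  obtain ⟨t, ht, htc⟩ := exists_dense_subset_submodule hs g.domain
  have htκ : #t < κ :=
    htc.trans_lt (mul_lt_of_lt hκ.le (hsc.trans_lt (max_lt hdim hκ)) hκ)
  -- As `κ` is uncountable, every tolerance `1 / (n + 1)` can be demanded at once, which forces
  -- exact equality on a dense set.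
  let F : Set (E × ℝ) := Set.range fun d : t × ULift.{u} ℕ => (g d.1, 1 / ((d.2.down : ℝ) + 1))
  have hF : #F < κ := by
    refine mk_range_le.trans_lt ?_
    simpa using mul_lt_of_lt hκ.le htκ hκ
  obtain ⟨x, hx⟩ := hreal p hp hpE F hF (by
    rintro _ ⟨d, rfl⟩
    positivity)
  have hxt : ∀ d ∈ t, ‖x + g d‖ = p (g d, 1) := by
    intro d hd
    rw [← sub_eq_zero, ← abs_nonpos_iff]
    exact ge_of_tendsto' tendsto_one_div_add_atTop_nhds_zero_nat
      fun n => hx _ ⟨(⟨d, hd⟩, ⟨n⟩), rfl⟩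
  have hcont : Continuous fun d : g.domain => g d :=
    AddMonoidHomClass.continuous_of_bound g.toFun M fun d => (hg d).2
  have h1 : ∀ d : g.domain, m * ‖(d : B) + b‖ ≤ ‖x + g d‖ ∧ ‖x + g d‖ ≤ M * ‖(d : B) + b‖ := by
    intro d
    have hcl : IsClosed ({d : g.domain | m * ‖(d : B) + b‖ ≤ ‖x + g d‖} ∩
        {d : g.domain | ‖x + g d‖ ≤ M * ‖(d : B) + b‖}) :=
      IsClosed.inter (isClosed_le (by fun_prop) (by fun_prop))
        (isClosed_le (by fun_prop) (by fun_prop))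
    refine (hcl.closure_subset_iff.2 fun d hd => ?_) (ht d)
    have := hpb d 1
    rw [one_smul] at this
    simpa [hxt d hd] using this
  refine LinearPMap.IsBoundedBetween.exists_extension hb (x := x) fun d c => ?_
  rcases eq_or_ne c 0 with rfl | hc
  · simpa using hg d
  have h2 := h1 (c⁻¹ • d)
  have hc' : 0 < |c| := abs_pos.2 hc
  have h3 : (d : B) + c • b = c • (((c⁻¹ • d : g.domain) : B) + b) := by
    rw [smul_add, Submodule.coe_smul, smul_smul, mul_inv_cancel₀ hc, one_smul]
  have h4 : g d + c • x = c • (x + g (c⁻¹ • d)) := by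
    rw [smul_add, LinearPMap.map_smul, smul_smul, mul_inv_cancel₀ hc, one_smul, add_comm]
  rw [h3, h4, norm_smul, norm_smul, Real.norm_eq_abs]
  constructor
  · calc m * (|c| * _) = |c| * (m * _) := by ring
      _ ≤ _ := mul_le_mul_of_nonneg_left h2.1 hc'.le
  · calc |c| * _ ≤ |c| * (M * _) := mul_le_mul_of_nonneg_left h2.2 hc'.le
      _ = _ := by ring

/-- One-step extension with an arbitrarily small loss, for finite-dimensional spaces. -/
theorem RealizesExtensions.exists_extension_of_finiteDimensional {κ : Cardinal.{u}}
    (hreal : RealizesExtensions E X κ) (hκ : ℵ₀ ≤ κ) (hX : HasIsomorphicAmalgamation X)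
    (hB : (normSeminorm ℝ B).FinRep X) (hE : (normSeminorm ℝ E).FinRep X)
    [FiniteDimensional ℝ B] {g : B →ₗ.[ℝ] E} {m M m' M' : ℝ} (hm : 0 < m)
    (hmM : m ≤ M) (hm' : m' < m) (hM' : M < M') (hg : g.IsBoundedBetween m M) {b : B}
    (hb : b ∉ g.domain) :
    ∃ g' : B →ₗ.[ℝ] E, g ≤ g' ∧ b ∈ g'.domain ∧ g'.IsBoundedBetween m' M' := by
  classical
  have hM : 0 < M := hm.trans_le hmM
  obtain ⟨p, hp, hpE, hpb⟩ := hX.exists_seminorm_prod_real hB hE hm hmM hg b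
  have hex : ∀ S : Finset g.domain × ℕ, ∃ x : E, ∀ d ∈ S.1,
      |‖x + g d‖ - p (g d, 1)| ≤ 1 / ((S.2 : ℝ) + 1) := by
    intro S
    obtain ⟨x, hx⟩ := hreal p hp hpE
      ((S.1.image fun d => (g d, 1 / ((S.2 : ℝ) + 1)) : Finset (E × ℝ)) : Set (E × ℝ))
      ((lt_aleph0_of_finite _).trans_le hκ) (by
        intro y hy
        obtain ⟨d, -, rfl⟩ := Finset.mem_image.1 (Finset.mem_coe.1 hy)
        positivity)
    exact ⟨x, fun d hd => hx _ (Finset.mem_coe.2 (Finset.mem_image_of_mem _ hd))⟩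
  choose x hx using hex
  -- The seminorms `σ S` of approximate realizations converge pointwise to `ρ`, which is a norm
  -- because `b ∉ g.domain`; finite dimension makes the comparison uniform.
  let ρ : Seminorm ℝ (g.domain × ℝ) := p.comp (g.toFun.prodMap LinearMap.id)
  have hρ : ∀ (d : g.domain) (t : ℝ), ρ (d, t) = p (g d, t) := fun d t => rfl
  let σ : Finset g.domain × ℕ → Seminorm ℝ (g.domain × ℝ) := fun S =>
    (normSeminorm ℝ E).comp (g.toFun.coprod (LinearMap.toSpanSingleton ℝ E (x S)))
  have hσ : ∀ S (d : g.domain) (t : ℝ), σ S (d, t) = ‖g d + t • x S‖ := fun S d t => rfl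
  have hdef : ∀ w, ρ w = 0 → w = 0 := by
    rintro ⟨d, t⟩ hw
    have h1 := (hpb d t).1
    rw [← hρ, hw] at h1
    have h2 : (d : B) + t • b = 0 := norm_le_zero_iff.1 (nonpos_of_mul_nonpos_right h1 hm)
    have ht : t = 0 := by
      by_contra ht
      apply hb
      have : b = (-t⁻¹) • (d : B) := by
        rw [eq_neg_of_add_eq_zero_left h2, smul_neg, neg_smul, neg_neg, smul_smul,
          inv_mul_cancel₀ ht, one_smul]
      rw [this]
      exact Submodule.smul_mem _ _ d.2
    subst ht
    rw [zero_smul, add_zero] at h2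
    exact Prod.ext (Subtype.ext h2) rfl
  have hlim : ∀ w, Tendsto (fun S => σ S w) atTop (𝓝 (ρ w)) := by
    rintro ⟨d, t⟩
    rcases eq_or_ne t 0 with rfl | ht
    · have : ∀ S, σ S (d, 0) = ρ (d, 0) := fun S => by rw [hσ, hρ, hpE, zero_smul, add_zero]
      simp only [this]
      exact tendsto_const_nhds
    have h1 : Tendsto (fun S : Finset g.domain × ℕ => |t| * (1 / ((S.2 : ℝ) + 1))) atTop (𝓝 0) := by
      have h2 : Tendsto (fun S : Finset g.domain × ℕ => S.2) atTop atTop := by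
        rw [← prod_atTop_atTop_eq]
        exact tendsto_snd
      simpa using (tendsto_one_div_add_atTop_nhds_zero_nat.comp h2).const_mul |t|
    rw [tendsto_iff_norm_sub_tendsto_zero]
    refine squeeze_zero' (Eventually.of_forall fun _ => norm_nonneg _) ?_ h1
    filter_upwards [eventually_ge_atTop (({t⁻¹ • d}, 0) : Finset g.domain × ℕ)] with S hS
    have h2 := hx S (t⁻¹ • d) (hS.1 (by simp))
    have h3 : σ S (d, t) = |t| * ‖x S + g (t⁻¹ • d)‖ := by
      rw [hσ, ← Real.norm_eq_abs, ← norm_smul, smul_add, LinearPMap.map_smul, smul_smul,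
        mul_inv_cancel₀ ht, one_smul, add_comm]
    have h4 : ρ (d, t) = |t| * p (g (t⁻¹ • d), 1) := by
      rw [hρ, ← Real.norm_eq_abs, ← map_smul_eq_mul, Prod.smul_mk, LinearPMap.map_smul, smul_smul,
        mul_inv_cancel₀ ht, one_smul, smul_eq_mul, mul_one]
    rw [h3, h4, ← mul_sub, Real.norm_eq_abs, abs_mul, abs_abs]
    exact mul_le_mul_of_nonneg_left h2 (abs_nonneg t)
  obtain ⟨ε, hε, hε1, hε2⟩ : ∃ ε : ℝ, 0 < ε ∧ ε * m ≤ m - m' ∧ ε * M ≤ M' - M := by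
    refine ⟨min ((m - m') / m) ((M' - M) / M), lt_min (div_pos (by linarith) hm)
      (div_pos (by linarith) hM), ?_, ?_⟩
    · rw [← le_div_iff₀ hm]
      exact min_le_left _ _
    · rw [← le_div_iff₀ hM]
      exact min_le_right _ _
  obtain ⟨ε', hε', hε'1, hε'ε⟩ : ∃ ε' : ℝ, 0 < ε' ∧ ε' ≤ 1 ∧ ε' ≤ ε :=
    ⟨min 1 ε, by positivity, min_le_left _ _, min_le_right _ _⟩
  obtain ⟨S, hS⟩ := (Seminorm.eventually_ratio_le hdef hlim hε').exists
  refine LinearPMap.IsBoundedBetween.exists_extension hb (x := x S) fun d t => ?_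
  obtain ⟨h1, h2⟩ := hS (d, t)
  obtain ⟨h3, h4⟩ := hpb d t
  rw [hσ, hρ] at h1 h2
  have hn := norm_nonneg ((d : B) + t • b)
  constructor
  · calc m' * ‖(d : B) + t • b‖ ≤ ((1 - ε') * m) * ‖(d : B) + t • b‖ := by
          refine mul_le_mul_of_nonneg_right ?_ hn
          nlinarith
      _ = (1 - ε') * (m * ‖(d : B) + t • b‖) := by ring
      _ ≤ (1 - ε') * p (g d, t) := mul_le_mul_of_nonneg_left h3 (by linarith)
      _ ≤ _ := h1
  · calc ‖g d + t • x S‖ ≤ (1 + ε') * p (g d, t) := h2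
      _ ≤ (1 + ε') * (M * ‖(d : B) + t • b‖) := mul_le_mul_of_nonneg_left h4 (by linarith)
      _ = ((1 + ε') * M) * ‖(d : B) + t • b‖ := by ring
      _ ≤ _ := by
        refine mul_le_mul_of_nonneg_right ?_ hn
        nlinarith

/-- One-step extensions keep `m` and `M`, and so do unions of chains; a maximal extension is
therefore total. -/
theorem RealizesExtensions.exists_total_of_aleph0_lt {κ : Cardinal.{u}}
    (hreal : RealizesExtensions E X κ) (hκ : ℵ₀ < κ) (hX : HasIsomorphicAmalgamation X)
    (hB : (normSeminorm ℝ B).FinRep X) (hE : (normSeminorm ℝ E).FinRep X)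
    (hdim : banachDim B < κ) {g : B →ₗ.[ℝ] E} {m M : ℝ} (hm : 0 < m)
    (hmM : m ≤ M) (hg : g.IsBoundedBetween m M) :
    ∃ g' : B →ₗ.[ℝ] E, g ≤ g' ∧ g'.domain = ⊤ ∧ g'.IsBoundedBetween m M := by
  obtain ⟨g', hgg', hg', hmax⟩ := zorn_le_nonempty₀ {g : B →ₗ.[ℝ] E | g.IsBoundedBetween m M}
    (fun c hcs hc y hy => by
      have hne : c.Nonempty := ⟨y, hy⟩
      refine ⟨LinearPMap.sSup c hc.directedOn, ?_, fun _ => LinearPMap.le_sSup hc.directedOn⟩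
      rintro ⟨d, hd⟩
      obtain ⟨f, hf, hdf⟩ := (LinearPMap.mem_domain_sSup_iff hne hc.directedOn).1 hd
      have h1 := LinearPMap.sSup_apply hc.directedOn hf ⟨d, hdf⟩
      have h2 := hcs hf ⟨d, hdf⟩
      rw [← h1] at h2
      exact h2) g hg
  refine ⟨g', hgg', ?_, hg'⟩
  by_contra htop
  obtain ⟨b, hb⟩ : ∃ b, b ∉ g'.domain := by
    by_contra! hcon
    exact htop (Submodule.eq_top_iff'.2 hcon)
  obtain ⟨f, hf, hbf, hfb⟩ := hreal.exists_extension_of_aleph0_lt hκ hX hB hE hdim hm hmM hg' hb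
  exact hb ((hmax hfb hf).1 hbf)

/-- Induction on the codimension of the domain, each step using half of the remaining gaps between
`m'` and `m` and between `M` and `M'`. -/
theorem RealizesExtensions.exists_total_of_finiteDimensional {κ : Cardinal.{u}}
    (hreal : RealizesExtensions E X κ) (hκ : ℵ₀ ≤ κ) (hX : HasIsomorphicAmalgamation X)
    (hB : (normSeminorm ℝ B).FinRep X) (hE : (normSeminorm ℝ E).FinRep X)
    [FiniteDimensional ℝ B] {g : B →ₗ.[ℝ] E} {m M m' M' : ℝ} (hm'0 : 0 < m')
    (hmM : m ≤ M) (hm' : m' < m) (hM' : M < M') (hg : g.IsBoundedBetween m M) :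
    ∃ g' : B →ₗ.[ℝ] E, g ≤ g' ∧ g'.domain = ⊤ ∧ g'.IsBoundedBetween m' M' := by
  induction h : Module.finrank ℝ B - Module.finrank ℝ g.domain using Nat.strong_induction_on
    generalizing g m M with
  | _ n ih =>
    by_cases htop : g.domain = ⊤
    · refine ⟨g, le_rfl, htop, fun d => ⟨le_trans ?_ (hg d).1, (hg d).2.trans ?_⟩⟩
      · exact mul_le_mul_of_nonneg_right hm'.le (norm_nonneg _)
      · exact mul_le_mul_of_nonneg_right hM'.le (norm_nonneg _)
    obtain ⟨b, hb⟩ : ∃ b, b ∉ g.domain := by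
      by_contra! hcon
      exact htop (Submodule.eq_top_iff'.2 hcon)
    obtain ⟨f, hf, hbf, hfb⟩ := hreal.exists_extension_of_finiteDimensional hκ hX hB hE
      (m' := (m + m') / 2) (M' := (M + M') / 2) (hm'0.trans hm') hmM (by linarith)
      (by linarith) hg hb
    have hlt : g.domain < f.domain := lt_of_le_of_ne hf.1 fun h => hb (h ▸ hbf)
    have h1 := Submodule.finrank_lt_finrank_of_lt hlt
    have h2 := Submodule.finrank_le f.domain
    obtain ⟨k, hk, hktop, hkb⟩ := ih _ (by omega) (by linarith) (by linarith) (by linarith) hfb rfl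
    exact ⟨k, hf.trans hk, hktop, hkb⟩

/-- The extension property for spaces of dimension less than `κ`. -/
theorem RealizesExtensions.exists_extension {κ : Cardinal.{u}}
    (hreal : RealizesExtensions E X κ) (hκ : ℵ₀ ≤ κ) (hX : HasIsomorphicAmalgamation X)
    (hB : (normSeminorm ℝ B).FinRep X) (hE : (normSeminorm ℝ E).FinRep X)
    (hdim : banachDim B < κ) {A : Submodule ℝ B} (i : A →L[ℝ] E) (hi : IsIsomorphicEmbedding i)
    {ε : ℝ} (hε : 0 < ε) :
    ∃ j : B →L[ℝ] E, IsIsomorphicEmbedding j ∧ (∀ a : A, j (a : B) = i a) ∧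
      distortion j ≤ (1 + ε) * distortion i := by
  obtain ⟨m, M, hm, hmM, hb, hM⟩ := hi.exists_bounds
  have hMpos : 0 < M := hm.trans_le hmM
  -- The solution of `(1 + δ) / (1 - δ) = 1 + ε`.
  let δ : ℝ := ε / (2 + ε)
  have hδ0 : 0 < δ := by positivity
  have hδ1 : δ < 1 := by
    rw [div_lt_one (by positivity)]
    linarith
  have hδ : (1 + δ) = (1 + ε) * (1 - δ) := by
    simp only [δ]
    field_simp
    ring
  let g : B →ₗ.[ℝ] E := ⟨A, i⟩
  have hg : g.IsBoundedBetween m M := hb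
  have hm' : (1 - δ) * m < m := by nlinarith
  have hM' : M < (1 + δ) * M := by nlinarith
  have hm'0 : 0 < (1 - δ) * m := mul_pos (by linarith) hm
  have hex : ∃ g' : B →ₗ.[ℝ] E, g ≤ g' ∧ g'.domain = ⊤ ∧
      g'.IsBoundedBetween ((1 - δ) * m) ((1 + δ) * M) := by
    rcases hκ.lt_or_eq with hκ' | rfl
    · obtain ⟨g', h1, h2, h3⟩ :=
        hreal.exists_total_of_aleph0_lt hκ' hX hB hE hdim hm hmM hg
      refine ⟨g', h1, h2, fun d => ⟨le_trans ?_ (h3 d).1, (h3 d).2.trans ?_⟩⟩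
      · exact mul_le_mul_of_nonneg_right hm'.le (norm_nonneg _)
      · exact mul_le_mul_of_nonneg_right hM'.le (norm_nonneg _)
    · have := finiteDimensional_of_banachDim_lt_aleph0 hdim
      exact hreal.exists_total_of_finiteDimensional le_rfl hX hB hE hm'0 hmM hm' hM' hg
  obtain ⟨g', hgg', htop, hg'⟩ := hex
  let J : B →ₗ[ℝ] E := g'.toFun ∘ₗ LinearMap.codRestrict g'.domain LinearMap.id fun x => by
    rw [htop]; trivial
  have hJ : ∀ x : B, (1 - δ) * m * ‖x‖ ≤ ‖J x‖ ∧ ‖J x‖ ≤ (1 + δ) * M * ‖x‖ := fun x =>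
    hg' ⟨x, by rw [htop]; trivial⟩
  let j : B →L[ℝ] E := J.mkContinuous ((1 + δ) * M) fun x => (hJ x).2
  refine ⟨j, isIsomorphicEmbedding_of_bounds hm'0 hJ, fun a => ?_, ?_⟩
  · exact (hgg'.2 (x := a) (y := ⟨(a : B), by rw [htop]; trivial⟩) rfl).symm
  · refine (distortion_le_of_bounds (T := j) hm'0 (by linarith) hJ).trans ?_
    rw [div_le_iff₀ hm'0, hδ]
    have h1 : 0 ≤ (1 + ε) * (1 - δ) := mul_nonneg (by linarith) (by linarith)
    calc (1 + ε) * (1 - δ) * M ≤ (1 + ε) * (1 - δ) * (distortion i * m) :=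
          mul_le_mul_of_nonneg_left hM h1
      _ = _ := by ring

end Extension

/-! ### The dimension of the space and the theorem -/

section Main

open Cardinal

variable {X E : Type u} [NormedAddCommGroup X] [NormedSpace ℝ X]
  [NormedAddCommGroup E] [NormedSpace ℝ E]

/-- Fewer than `κ` points come close to a ball in a space of dimension less than `κ`. -/
theorem exists_net_of_banachDim_lt {κ : Cardinal.{u}} (hκ : ℵ₀ ≤ κ) (h : banachDim E < κ) (R : ℝ) :
    ∃ s : Set E, #s < κ ∧ ∀ x, ‖x‖ ≤ R → ∃ y ∈ s, ‖x + y‖ < 1 / 2 := by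
  rcases hκ.lt_or_eq with hκ' | rfl
  · obtain ⟨s, hs, hsc⟩ := exists_dense_mk_le E
    refine ⟨s, hsc.trans_lt (max_lt h hκ'), fun x _ => ?_⟩
    obtain ⟨y, hy, hxy⟩ := hs.exists_dist_lt (-x) (show (0 : ℝ) < 1 / 2 by norm_num)
    refine ⟨y, hy, ?_⟩
    rwa [dist_eq_norm, ← norm_neg, neg_sub, sub_neg_eq_add, add_comm] at hxy
  · have := finiteDimensional_of_banachDim_lt_aleph0 h
    have : ProperSpace E := FiniteDimensional.proper_real E
    obtain ⟨s, -, hs, hcov⟩ := (isCompact_closedBall (0 : E) R).finite_cover_balls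
      (show (0 : ℝ) < 1 / 2 by norm_num)
    refine ⟨s, lt_aleph0_iff_set_finite.2 hs, fun x hx => ?_⟩
    have hx' : -x ∈ ⋃ y ∈ s, Metric.ball y (1 / 2) := hcov (by simpa using hx)
    simp only [Set.mem_iUnion, Metric.mem_ball, exists_prop] at hx'
    obtain ⟨y, hy, hxy⟩ := hx'
    refine ⟨y, hy, ?_⟩
    rwa [dist_eq_norm, ← norm_neg, neg_sub, sub_neg_eq_add, add_comm] at hxy

/-- In smaller dimension, a vector of norm at most `2` and distance at least `1` from `E` could be
imitated within `1 / 2` over a net. The imitation `x` would satisfy `‖x + y‖ ≥ 1 / 2` for all `y` in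
the net, against the choice of the net. -/
theorem RealizesExtensions.le_banachDim {κ : Cardinal.{u}} (hreal : RealizesExtensions E X κ)
    (hκ : ℵ₀ ≤ κ) (hdim : ¬ FiniteDimensional ℝ X) (hE : (normSeminorm ℝ E).FinRep X) :
    κ ≤ banachDim E := by
  by_contra hlt
  obtain ⟨p, hp, hpE, hp1, hp2⟩ := hE.exists_proper_extension hdim
  obtain ⟨s, hs, hnet⟩ := exists_net_of_banachDim_lt hκ (not_le.1 hlt) 3
  -- The point `0` is added to get `‖x‖ ≤ 2 + 1 / 2`, within the radius `3` covered by the net.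
  have hF : #(((fun e => (e, (1 / 2 : ℝ))) '' (insert 0 s) : Set (E × ℝ))) < κ := by
    refine mk_image_le.trans_lt (mk_insert_le.trans_lt ?_)
    exact add_lt_of_lt hκ hs (one_lt_aleph0.trans_le hκ)
  obtain ⟨x, hx⟩ := hreal p hp hpE _ hF (by
    rintro _ ⟨e, -, rfl⟩
    norm_num)
  have h1 := abs_le.1 (hx _ ⟨0, Set.mem_insert _ _, rfl⟩)
  simp only [add_zero] at h1
  obtain ⟨y, hy, hxy⟩ := hnet x (by linarith [h1.2])
  have h2 := abs_le.1 (hx _ ⟨y, Set.mem_insert_of_mem _ hy, rfl⟩)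
  simp only at h2
  linarith [h2.1, hp1 y]

end Main

theorem mainTheorem8 (X : Type u) [NormedAddCommGroup X] [NormedSpace ℝ X] [CompleteSpace X]
    (hdim : ¬ FiniteDimensional ℝ X) (hX : HasIsomorphicAmalgamation X)
    (κ : Cardinal.{u}) (hκ : IsStarCardinal κ) :
    ∃ (E : Type u) (_ : NormedAddCommGroup E) (_ : NormedSpace ℝ E),
      CompleteSpace E ∧ FinitelyEquivalent E X ∧ banachDim E = κ ∧ IsFSaturated E := by
  obtain ⟨E, _, _, hcE, hE, hle, hreal⟩ := hκ.exists_realizesExtensions X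
  have hκ0 := hκ.1.aleph0_le
  have hEκ : banachDim E = κ := le_antisymm hle (hreal.le_banachDim hκ0 hdim hE)
  refine ⟨E, _, _, hcE, ⟨hE.finitelyRepresentable, fun A hA ε hε => ?_⟩, hEκ, ?_⟩
  -- A finite-dimensional subspace of `X` embeds in `E` by extending the zero map on `⊥`, whose
  -- distortion is `1`.
  · have h0 : ∀ x : (⊥ : Submodule ℝ A), x = 0 := fun x => Subsingleton.elim _ _
    have h1 : ∀ x, (1 : ℝ) * ‖x‖ ≤ ‖(0 : (⊥ : Submodule ℝ A) →L[ℝ] E) x‖ ∧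
        ‖(0 : (⊥ : Submodule ℝ A) →L[ℝ] E) x‖ ≤ 1 * ‖x‖ := fun x => by simp [h0 x]
    obtain ⟨j, hj, -, hd⟩ := hreal.exists_extension hκ0 hX
      (Seminorm.finRep_normSeminorm_self.submodule A) hE
      ((banachDim_lt_aleph0 A).trans_le hκ0) (A := ⊥) 0
      (isIsomorphicEmbedding_of_bounds one_pos h1) hε
    have h2 := distortion_le_of_bounds one_pos le_rfl h1
    refine ⟨j, hj, hd.trans ?_⟩
    nlinarith
  · intro B _ _ _ A _ _ hB i hi ε hε
    exact hreal.exists_extension hκ0 hX (hB.1.finRep.trans hE) hE (hEκ ▸ hB.2) i hi hε
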